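/- **Setting.** Positions are the points $x=(p,q)\in\mathbb Z^2$ (column $p$, row $q$) of the hexagonal lattice in axial coordinates. Walls are indexed by $w\in\mathbb Z/6$, counter-clockwise, with unit vectors $\hat u_0=(0,1)$ (F), $\hat u_1=(-1,1)$ (FL), $\hat u_2=(-1,0)$ (RL), $\hat u_3=(0,-1)$ (R), $\hat u_4=(1,-1)$ (RR), $\hat u_5=(1,0)$ (FR); the walls $0,3$ are the fore-aft walls, $\{1,2\}$ is the left flank and $\{4,5\}$ the right flank; $x,y$ are adjacent if $y=x+\hat u_w$ for some $w$. The target shape $S\subset\mathbb Z^2$ is finite, contains the origin, and is hole-free: no simple cycle of adjacent positions of $S$, viewed as a closed polygon through the hexagon centres, has a position outside $S$ in its interior. Its perimeter $X_b$ is the set of $x\in S$ with at least one adjacent position outside $S$. Robots know $X_b$ only; they take as *target positions* those that lie in $X_b$ or are enclosed (ray casting) by a minimal, i.e. chordless simple, cycle contained in $X_b$. A *segment* is a maximal set of consecutive target positions in one column; its midpoint is rounded down. **Wall status.** Let $X(t)$ be the set of occupied positions at time $t$. The wall $w$ of a robot at $x$ is *null* if $x+\hat u_w$ is not a target position; otherwise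 it is *occupied* or *free* according to whether $x+\hat u_w\in X(t)$. Write $s_{i,w}$ for the status of wall $w$ of robot $i$. **Initialization (once, when robot $i$ at $x_i=(p_i,q_i)$ attaches).** For each flank (with $a=-1$ for left, $a=1$ for right) the robot determines a flag $\alpha_{\rm left},\alpha_{\rm right}$ as follows. 1. If no wall of the flank is free, the flag is false. 2. Otherwise, if some free wall of the flank has both neighbouring walls null, the flag is true. 3. Otherwise, let $Q$ be the segment of column $p_i+a$ that the flank faces, $q_m$ the row of its midpoint, and $Q_{p_i}$ the segment containing $x_i$. If $q_i=q_m$, the flag is true; if $q_i\ne q_m$ and $(p_i,q_m)\in Q_{p_i}$, it is false; otherwise it is true if and only if $q_i$ is, among the rows $r$ with $(p_i+a,r)\in Q$ and $(p_i,r)\in Q_{p_i}$, a nearest one to $q_m$. The growth direction is $g_i=0$ if both flags are true; else $g_i=1$ if $s_{i,1}$ or $s_{i,2}$ is occupied or $\alpha_{\rm right}$ is true; else $g_i=-1$ if $s_{i,4}$ or $s_{i,5}$ is occupied or $\alpha_{\rm left}$ is true; else $g_i=0$. The flags and $g_i$ stay fixed. **Signal activation (at each time step).** The nominal walls $W_i$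 are the free fore-aft walls if there are any. Otherwise they are the free flank walls $w$ such that at least one of the following holds: both neighbouring walls of $w$ are occupied; one neighbouring wall is a null fore-aft wall and the other is occupied; the flag of the flank of $w$ is true. The delayed walls $\tilde W_i$ are: if $g_i=-1$, wall $0$ if wall $5$ is occupied by a neighbour whose wall $0$ is free, and wall $3$ if wall $4$ is occupied by a neighbour whose wall $3$ is free; if $g_i=1$, the same with $1,2$ in place of $5,4$; if $g_i=0$, none. Robot $i$ signals on $W_i\setminus\tilde W_i$. **Executions.** $X(0)=\{(0,0)\}$, with the root robot initialized there. At each time step $t=0,1,2,\dots$, new robots attach at an arbitrary (possibly empty) finite set of unoccupied positions, each of which is faced by a wall that signals at time $t$; the new robots are initialized with the wall statuses after these attachments. The assembly graph $G(t)$ has the vertex set $X(t)$ and an edge between any two adjacent positions. **Theorem (Reachability).** For every such $S$, every execution and every time $t$ (in particular, every $t$ before completion of $S$), $G(t)$ maintains reachability: for every $y\in S\setminus X(t)$ adjacent to a position of $X(t)$, the vertex at $y$ in the assembly graph on $X(t)\cup\{y\}$ satisfies $1\le\deg\le 3$. -/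

import Mathlib

noncomputable section

namespace Huddle

/-! ### The hexagonal lattice -/

/-- Positions `(p, q)` of the hexagonal lattice in axial coordinates:
`p` is the column, `q` is the row. -/
abbrev Cell : Type := ℤ × ℤ

/-- Wall indices, counter-clockwise: `0 = F`, `1 = FL`, `2 = RL`, `3 = R`, `4 = RR`, `5 = FR`.
Addition and subtraction of indices are modulo `6`, so the two walls next to `w` are
`w - 1` and `w + 1`. -/
abbrev Wall : Type := Fin 6

/-- The unit vector pointing in the direction of wall `w`. -/
def unitVec : Wall → Cell :=
  ![(0, 1), (-1, 1), (-1, 0), (0, -1), (1, -1), (1, 0)]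

/-- The opposite wall has the opposite unit vector. -/
theorem unitVec_opposite (w : Wall) : unitVec (w + 3) = -unitVec w := by
  fin_cases w <;> rfl

/-- No unit vector vanishes. -/
theorem unitVec_ne_zero (w : Wall) : unitVec w ≠ 0 := by
  fin_cases w <;> simp [unitVec]

/-- The adjacency graph of the hexagonal lattice. -/
def hexGraph : SimpleGraph Cell where
  Adj x y := ∃ w : Wall, y = x + unitVec w
  symm := ⟨by
    rintro x y ⟨w, rfl⟩
    exact ⟨w + 3, by rw [unitVec_opposite]; abel⟩⟩
  loopless := ⟨by
    rintro x ⟨w, h⟩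
    exact unitVec_ne_zero w (by simpa using h)⟩

instance : DecidableRel hexGraph.Adj := fun x y =>
  inferInstanceAs (Decidable (∃ w : Wall, y = x + unitVec w))

/-- The assembly graph with occupied positions `X`: one vertex for each robot (identified with
its position), and an edge for each pair of attached robots. -/
def assemblyGraph (X : Finset Cell) : SimpleGraph {x // x ∈ X} :=
  hexGraph.comap Subtype.val

instance (X : Finset Cell) : DecidableRel (assemblyGraph X).Adj := fun x y =>
  inferInstanceAs (Decidable (hexGraph.Adj x.1 y.1))

/-! ### Reachability -/

/-- The unoccupied target positions that are adjacent to an occupied one. -/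
def openings (S X : Finset Cell) : Set Cell :=
  {y | y ∈ S ∧ y ∉ X ∧ ∃ x ∈ X, hexGraph.Adj y x}

/-- The degree that a new vertex at position `y` has in the assembly graph after it is added. -/
def degreeIfAdded (X : Finset Cell) (y : Cell) : ℕ :=
  (assemblyGraph (insert y X)).degree ⟨y, Finset.mem_insert_self y X⟩

/-- The assembly with occupied positions `X` maintains reachability with respect to the target
shape `S`. -/
def MaintainsReachability (S X : Finset Cell) : Prop :=
  ∀ y ∈ openings S X, 1 ≤ degreeIfAdded X y ∧ degreeIfAdded X y ≤ 3

/-! ### Cycles, enclosed positions, hole-free shapes -/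

/-- Twice the Cartesian ordinate of the centre of a hexagon (two neighbours in a column are
at distance `1`). The Cartesian abscissa is a fixed multiple of the column. -/
def height (x : Cell) : ℤ := 2 * x.2 + x.1

/-- The segment from the centre of `a` up to the centre of the adjacent cell `b` crosses the
horizontal ray that starts at the centre of `y` and points left; a crossing in the upper end
point `b` is not counted (the half-open rule of ray casting). If `a` and `b` lie in one column,
the crossing is in that column; otherwise `height b = height a + 1`, so that the crossing is
the point `a` itself. In both cases it is left of `y` exactly if `a.1 < y.1`. -/
def UpCrossing (y a b : Cell) : Prop :=
  height a ≤ height y ∧ height y < height b ∧ a.1 < y.1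

open Classical in
/-- The number of edges of a closed walk that cross the ray starting at `y`. -/
def crossingNumber {v : Cell} (c : hexGraph.Walk v v) (y : Cell) : ℕ :=
  c.darts.countP fun d => decide (UpCrossing y d.fst d.snd ∨ UpCrossing y d.snd d.fst)

/-- The position `y` lies in the interior of the closed polygon `c` (ray casting, even-odd
rule). -/
def Encloses {v : Cell} (c : hexGraph.Walk v v) (y : Cell) : Prop :=
  y ∉ c.support ∧ Odd (crossingNumber c y)

/-- A shape is hole-free if no simple cycle in it encloses a position outside the shape. -/
def HoleFree (S : Finset Cell) : Prop :=
  ∀ (v : Cell) (c : hexGraph.Walk v v), c.IsCycle → (∀ x ∈ c.support, x ∈ S) →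
    ∀ y, Encloses c y → y ∈ S

/-- The perimeter of `S`: the hexagons of `S` with at least one unattached side. -/
def perimeter (S : Finset Cell) : Finset Cell :=
  S.filter fun x => ∃ w : Wall, x + unitVec w ∉ S

/-- `c` is a minimal (that is, simple and chordless) cycle contained in `B`. -/
def IsMinimalCycle (B : Finset Cell) {v : Cell} (c : hexGraph.Walk v v) : Prop :=
  c.IsCycle ∧ (∀ x ∈ c.support, x ∈ B) ∧
    ∀ x ∈ c.support, ∀ y ∈ c.support, hexGraph.Adj x y → s(x, y) ∈ c.edges

/-- The positions that a robot takes for target positions, given only the perimeter `B`: those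
in `B` and those enclosed by a minimal cycle contained in `B`. -/
def targetOf (B : Finset Cell) : Set Cell :=
  {y | y ∈ B ∨ ∃ (v : Cell) (c : hexGraph.Walk v v), IsMinimalCycle B c ∧ Encloses c y}

/-! ### Walls -/

inductive WallStatus : Type
  | null
  | free
  | occupied
  deriving DecidableEq

/-- A wall status vector. -/
abbrev StatusVec : Type := Wall → WallStatus

open Classical in
/-- The wall status vector of a robot at `x`, where `B` is the perimeter and `X` the set of
occupied positions. Connection walls are those that face a position in `targetOf B`. -/
def status (B X : Finset Cell) (x : Cell) : StatusVec := fun w =>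
  if x + unitVec w ∉ targetOf B then WallStatus.null
  else if x + unitVec w ∈ X then WallStatus.occupied
  else WallStatus.free

inductive Flank : Type
  | left
  | right
  deriving DecidableEq

/-- The two walls of a flank. -/
def Flank.walls : Flank → Finset Wall
  | .left => {1, 2}
  | .right => {4, 5}

/-- The column direction of a flank. -/
def Flank.dir : Flank → ℤ
  | .left => -1
  | .right => 1

/-! ### Role determination -/

/-- Role determination from the robot's own wall status vector; `none` is "undefined". -/
def roleFromSelf (s : StatusVec) (F : Flank) : Option Bool :=
  if ∃ w ∈ F.walls, s w = .free then
    if ∃ w ∈ F.walls, s w = .free ∧ s (w - 1) = .null ∧ s (w + 1) = .null then some true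
    else none
  else some false

/-- The rows of the maximal contiguous segment of target positions in column `p` that contains
`(p, r)` (empty if `(p, r)` is not a target position). -/
def colSegment (B : Finset Cell) (p r : ℤ) : Set ℤ :=
  {q | ∀ k ∈ Set.uIcc q r, (p, k) ∈ targetOf B}

/-- The target column `p`: its contiguous segments, each given by its set of rows. -/
def targetColumn (B : Finset Cell) (p : ℤ) : Set (Set ℤ) :=
  {Q | ∃ r : ℤ, (p, r) ∈ targetOf B ∧ Q = colSegment B p r}

/-- The row of the midpoint of a segment, rounded down. -/
def midRow (Q : Set ℤ) : ℤ := (sInf Q + sSup Q) / 2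

/-- `r` is a row of the adjacent segment `Q` that also is a row of the robot's own segment
`Q₀`, and among these rows it is nearest to the midpoint of `Q`. -/
def IsNearestConnection (Q Q₀ : Set ℤ) (r : ℤ) : Prop :=
  r ∈ Q ∩ Q₀ ∧ ∀ k ∈ Q ∩ Q₀, |r - midRow Q| ≤ |k - midRow Q|

open Classical in
/-- Role determination from the target adjacent column: `Q` is the segment of the adjacent
target column that the robot at `x` faces with its flank `F`. -/
def roleFromColumn (B : Finset Cell) (x : Cell) (F : Flank) : Bool :=
  decide (∃ Q ∈ targetColumn B (x.1 + F.dir), (∃ w ∈ F.walls, (x + unitVec w).2 ∈ Q) ∧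
    if x.2 = midRow Q then True
    else if midRow Q ∈ colSegment B x.1 x.2 then False
    else IsNearestConnection Q (colSegment B x.1 x.2) x.2)

/-- Nucleation requirement of a robot at `x` with wall status vector `s` on flank `F`. -/
def nucleation (B : Finset Cell) (s : StatusVec) (x : Cell) (F : Flank) : Bool :=
  match roleFromSelf s F with
  | some b => b
  | none => roleFromColumn B x F

/-- Growth direction. -/
def growthDirection (αl αr : Bool) (s : StatusVec) : ℤ :=
  if αl = true ∧ αr = true then 0
  else if (s 1 = .occupied ∨ s 2 = .occupied) ∨ αr = true then 1
  else if (s 4 = .occupied ∨ s 5 = .occupied) ∨ αl = true then -1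
  else 0

/-- What a robot determines once and for all when it is initialized. -/
structure Memory : Type where
  /-- nucleation requirement on the left flank -/
  αLeft : Bool
  /-- nucleation requirement on the right flank -/
  αRight : Bool
  /-- growth direction -/
  g : ℤ

/-- The initialization phase of a robot at `x` when the set of occupied positions is `X`. -/
def initialMemory (B X : Finset Cell) (x : Cell) : Memory :=
  let s := status B X x
  let αl := nucleation B s x .left
  let αr := nucleation B s x .right
  ⟨αl, αr, growthDirection αl αr s⟩

/-! ### Signal activation -/

/-- The special flank signal condition: `w` is between two occupied walls, or between a null
fore-aft wall and an occupied wall. -/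
def SpecialCondition (s : StatusVec) (w : Wall) : Prop :=
  (s (w - 1) = .occupied ∧ s (w + 1) = .occupied) ∨
  ((w - 1 = 0 ∨ w - 1 = 3) ∧ s (w - 1) = .null ∧ s (w + 1) = .occupied) ∨
  ((w + 1 = 0 ∨ w + 1 = 3) ∧ s (w + 1) = .null ∧ s (w - 1) = .occupied)

/-- The nominal signaling walls. -/
def nominalWalls (s : StatusVec) (αl αr : Bool) : Set Wall :=
  {w | (¬ ∀ k, s k = .occupied) ∧ s w = .free ∧
    if s 0 = .free ∨ s 3 = .free then w = 0 ∨ w = 3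
    else w ∈ ({1, 2, 4, 5} : Set Wall) ∧
      (SpecialCondition s w ∨
        (αl = true ∧ w ∈ Flank.left.walls) ∨ (αr = true ∧ w ∈ Flank.right.walls))}

/-- The walls with delayed activation; `s` is the robot's own status vector and `nb w` the
status vector of its neighbour at wall `w` (used only where `s w` is occupied). -/
def delayedWalls (s : StatusVec) (nb : Wall → StatusVec) (g : ℤ) : Set Wall :=
  {w | (g = -1 ∧
      ((w = 0 ∧ s 5 = .occupied ∧ nb 5 0 = .free) ∨
       (w = 3 ∧ s 4 = .occupied ∧ nb 4 3 = .free))) ∨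
    (g = 1 ∧
      ((w = 0 ∧ s 1 = .occupied ∧ nb 1 0 = .free) ∨
       (w = 3 ∧ s 2 = .occupied ∧ nb 2 3 = .free)))}

/-- The walls on which a robot at `x` with memory `m` signals. -/
def activeWalls (B X : Finset Cell) (x : Cell) (m : Memory) : Set Wall :=
  nominalWalls (status B X x) m.αLeft m.αRight \
    delayedWalls (status B X x) (fun w => status B X (x + unitVec w)) m.g

/-! ### Executions -/

/-- The state of the assembly: the occupied positions, and the memory of the robot at each of
them (the values at unoccupied positions are irrelevant). -/
structure Config : Type where
  occ : Finset Cell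
  mem : Cell → Memory

/-- An in-assembly robot signals towards the position `y`. -/
def Signaled (B : Finset Cell) (c : Config) (y : Cell) : Prop :=
  ∃ x ∈ c.occ, ∃ w ∈ activeWalls B c.occ x (c.mem x), y = x + unitVec w

/-- One time step: passing-by robots attach at an arbitrary finite set `N` of unoccupied
positions towards which some in-assembly robot signals, and each of them runs its
initialization phase; the other robots keep their memory. -/
def Step (B : Finset Cell) (c c' : Config) : Prop :=
  ∃ N : Finset Cell,
    (∀ y ∈ N, y ∉ c.occ ∧ Signaled B c y) ∧
    c'.occ = c.occ ∪ N ∧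
    (∀ x ∈ c.occ, c'.mem x = c.mem x) ∧
    (∀ y ∈ N, c'.mem y = initialMemory B c'.occ y)

/-- An execution of Huddle with perimeter `B`: it starts with the root robot alone, at the
origin. -/
def IsExecution (B : Finset Cell) (run : ℕ → Config) : Prop :=
  (run 0).occ = {(0, 0)} ∧ (run 0).mem (0, 0) = initialMemory B {(0, 0)} (0, 0) ∧
    ∀ t, Step B (run t) (run (t + 1))

end Huddle

end

/-!
Call the maximal runs of shape positions in a column segments, and join two of them by an edge if
they contain adjacent positions. In a hole-free shape this graph is a forest: a potential for the
crossing parity with respect to a position outside the shape shows that no cycle of segments can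
encircle it. The segment of the root robot thus makes it a rooted tree. A segment is entered from a
single position of its parent segment, the one whose nucleation flag is raised, and from then on it
is filled as an interval around the entry point. The delay rule lets a segment grow only alongside
occupied positions of its parent, so that every robot finds all its neighbours in the parent segment
occupied. Hence the occupied neighbours of an unoccupied position are not both above and below it,
and they lie in its own column and in the column of a single flank, which leaves at most three.

That robots, which know the perimeter only, compute the positions of the shape correctly is again a
matter of crossing parity: if no minimal perimeter cycle encloses an interior position, then the
parity has a potential on the perimeter, which Stokes' theorem on the triangular lattice excludes.
-/

noncomputable section

namespace Huddle

/-! ### Sums along walks -/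

section WalkSum

open SimpleGraph

variable {V V' M : Type*} {G : SimpleGraph V} {G' : SimpleGraph V'} [AddCommGroup M]
  {u v w : V}

/-- The integral of a 1-cochain `f` along a walk: the sum of its values on the darts. -/
def walkSum (f : V → V → M) (p : G.Walk u v) : M :=
  (p.darts.map fun d => f d.fst d.snd).sum

section

variable (f : V → V → M)

@[simp]
theorem walkSum_nil (u : V) : walkSum f (.nil : G.Walk u u) = 0 := rfl

@[simp]
theorem walkSum_cons (h : G.Adj u v) (p : G.Walk v w) :
    walkSum f (.cons h p) = f u v + walkSum f p := by
  simp [walkSum]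

theorem walkSum_append (p : G.Walk u v) (q : G.Walk v w) :
    walkSum f (p.append q) = walkSum f p + walkSum f q := by
  simp [walkSum]

theorem walkSum_map (e : G' →g G) {a b : V'} (p : G'.Walk a b) :
    walkSum f (p.map e) = walkSum (fun x y => f (e x) (e y)) p := by
  simp [walkSum, Function.comp_def]

theorem walkSum_rotate [DecidableEq V] (c : G.Walk v v) (hu : u ∈ c.support) :
    walkSum f (c.rotate u hu) = walkSum f c :=
  ((c.rotate_darts u hu).perm.map _).sum_eq

theorem walkSum_eq_of_isPath_of_mem_edges {p : G.Walk u v} (hp : p.IsPath)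
    (he : s(u, v) ∈ p.edges) : walkSum f p = f u v := by
  cases p with
  | nil => simp at he
  | @cons _ b _ h p =>
    have hb : v = b := by simpa using hp.eq_snd_of_mem_edges he
    subst hb
    rw [(Walk.isPath_iff_nil.1 hp.of_cons).eq_nil, walkSum_cons, walkSum_nil, add_zero]

end

variable {f : V → V → M}

theorem walkSum_reverse (hf : ∀ a b, f b a = -f a b) (p : G.Walk u v) :
    walkSum f p.reverse = -walkSum f p := by
  induction p with
  | nil => simp
  | @cons a b _ h p ih => simp [walkSum_append, ih, hf a b, add_comm]

theorem exists_isPath_walkSum_eq (hf : ∀ a b, f b a = -f a b)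
    (hc : ∀ (v : V) (c : G.Walk v v), c.IsCycle → walkSum f c = 0) (p : G.Walk u v) :
    ∃ q : G.Walk u v, q.IsPath ∧ walkSum f q = walkSum f p := by
  classical
  induction p with
  | nil => exact ⟨.nil, .nil, rfl⟩
  | @cons u b v h p ih =>
    obtain ⟨q, hq, hs⟩ := ih
    by_cases hu : u ∈ q.support
    · have hsplit : walkSum f (q.takeUntil u hu) + walkSum f (q.dropUntil u hu) = walkSum f q := by
        rw [← walkSum_append, Walk.take_spec]
      have hloop : f u b + walkSum f (q.takeUntil u hu) = 0 := by
        by_cases he : s(u, b) ∈ (q.takeUntil u hu).edges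
        · rw [walkSum_eq_of_isPath_of_mem_edges f (hq.takeUntil hu) (by rwa [Sym2.eq_swap]),
            hf u b, add_neg_cancel]
        · simpa using hc u (.cons h _) ((Walk.cons_isCycle_iff _ h).2 ⟨hq.takeUntil hu, he⟩)
      refine ⟨q.dropUntil u hu, hq.dropUntil hu, ?_⟩
      rw [walkSum_cons, ← hs, ← hsplit, ← add_assoc, hloop, zero_add]
    · exact ⟨.cons h q, hq.cons hu, by simp [hs]⟩

theorem walkSum_eq_walkSum (hf : ∀ a b, f b a = -f a b)
    (hc : ∀ (v : V) (c : G.Walk v v), c.IsCycle → walkSum f c = 0) (p q : G.Walk u v) :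
    walkSum f p = walkSum f q := by
  obtain ⟨r, hr, hs⟩ := exists_isPath_walkSum_eq hf hc (p.append q.reverse)
  rw [(Walk.isPath_iff_nil.1 hr).eq_nil, walkSum_nil, walkSum_append, walkSum_reverse hf] at hs
  rw [eq_neg_of_add_eq_zero_left hs.symm, neg_neg]

theorem exists_potential (hf : ∀ a b, f b a = -f a b)
    (hc : ∀ (v : V) (c : G.Walk v v), c.IsCycle → walkSum f c = 0) :
    ∃ φ : V → M, ∀ a b, G.Adj a b → f a b = φ b - φ a := by
  have hroot (v : V) : Nonempty (G.Walk (G.connectedComponentMk v).out v) :=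
    ConnectedComponent.exact (Quot.out_eq _)
  have hdiff {a b r s : V} (hab : G.Adj a b) (hrs : r = s) (p : G.Walk r a) (q : G.Walk s b) :
      f a b = walkSum f q - walkSum f p := by
    subst hrs
    rw [eq_sub_iff_add_eq', walkSum_eq_walkSum hf hc q (p.append (.cons hab .nil)),
      walkSum_append, walkSum_cons, walkSum_nil, add_zero]
  refine ⟨fun v => walkSum f (hroot v).some, fun a b hab => hdiff hab ?_ _ _⟩
  rw [ConnectedComponent.sound hab.reachable]

theorem exists_potential_on (hf : ∀ a b, f b a = -f a b) {T : Set V}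
    (hc : ∀ (v : V) (c : G.Walk v v), c.IsCycle → (∀ x ∈ c.support, x ∈ T) → walkSum f c = 0) :
    ∃ φ : V → M, ∀ a ∈ T, ∀ b ∈ T, G.Adj a b → f a b = φ b - φ a := by
  obtain ⟨φ, hφ⟩ := exists_potential (G := G.induce T) (f := fun a b => f a b)
    (fun a b => hf a b) fun v c hcyc => by
      let e : G.induce T →g G := (Embedding.induce T).toHom
      refine (walkSum_map f e c).symm.trans
        (hc (e v) (c.map e) (hcyc.map Subtype.val_injective) fun x hx => ?_)
      rw [Walk.support_map e c, List.mem_map] at hx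
      obtain ⟨y, -, rfl⟩ := hx
      exact y.2
  refine ⟨Function.extend Subtype.val φ 0, fun a ha b hb hab => ?_⟩
  have hext (x : T) : Function.extend Subtype.val φ 0 x.1 = φ x :=
    Subtype.val_injective.extend_apply φ 0 x
  rw [hext ⟨a, ha⟩, hext ⟨b, hb⟩]
  exact hφ ⟨a, ha⟩ ⟨b, hb⟩ hab

theorem two_le_length_of_notMem_edges {p : G.Walk u v} (hne : u ≠ v) (he : s(u, v) ∉ p.edges) :
    2 ≤ p.length := by
  match p with
  | .nil => exact absurd rfl hne
  | .cons h .nil => simp at he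
  | .cons _ (.cons _ _) => simp

theorem exists_shorter_isCycle_of_isChord (hf : ∀ a b, f b a = -f a b) {c : G.Walk v v}
    (hc : c.IsCycle) {a b : V} (hab : c.IsChord s(a, b)) :
    ∃ (c₁ : G.Walk a a) (c₂ : G.Walk b b), c₁.IsCycle ∧ c₂.IsCycle ∧
      c₁.length < c.length ∧ c₂.length < c.length ∧
      c₁.support ⊆ c.support ∧ c₂.support ⊆ c.support ∧
      walkSum f c = walkSum f c₁ + walkSum f c₂ := by
  classical
  obtain ⟨hadj, he, ha, hb⟩ := Walk.isChord_sym2Mk.1 hab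
  have hsupp : (c.rotate a ha).support ⊆ c.support := fun z => (c.mem_support_rotate_iff a ha).1
  rw [← walkSum_rotate f c ha, ← c.length_rotate a ha]
  replace he : s(a, b) ∉ (c.rotate a ha).edges := mt (c.rotate_edges a ha).mem_iff.1 he
  replace hb := (c.mem_support_rotate_iff a ha).2 hb
  replace hc := hc.rotate ha
  generalize c.rotate a ha = d at *
  obtain ⟨p, q, rfl⟩ := Walk.mem_support_iff_exists_append.1 hb
  rw [Walk.edges_append, List.mem_append, not_or] at he
  have he' : s(b, a) ∉ p.edges := by rw [Sym2.eq_swap]; exact he.1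
  have hp : p.IsPath := hc.isPath_of_append_left (Walk.not_nil_of_ne hadj.ne')
  have hq : q.IsPath := hc.isPath_of_append_right (Walk.not_nil_of_ne hadj.ne)
  have hp2 := two_le_length_of_notMem_edges hadj.ne he.1
  have hq2 := two_le_length_of_notMem_edges hadj.ne' (by rw [Sym2.eq_swap]; exact he.2)
  refine ⟨.cons hadj q, .cons hadj.symm p, (Walk.cons_isCycle_iff _ _).2 ⟨hq, he.2⟩,
    (Walk.cons_isCycle_iff _ _).2 ⟨hp, he'⟩, ?_, ?_, fun z hz => hsupp ?_, fun z hz => hsupp ?_,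
    ?_⟩
  · rw [Walk.length_cons, Walk.length_append]; omega
  · rw [Walk.length_cons, Walk.length_append]; omega
  · rw [Walk.support_cons, List.mem_cons] at hz
    exact (Walk.mem_support_append_iff p q).2 (.inr (hz.elim (· ▸ q.end_mem_support) id))
  · rw [Walk.support_cons, List.mem_cons] at hz
    exact (Walk.mem_support_append_iff p q).2 (.inl (hz.elim (· ▸ p.end_mem_support) id))
  · rw [walkSum_append, walkSum_cons, walkSum_cons, hf a b]
    abel

theorem walkSum_eq_zero_of_forall_isChordless (hf : ∀ a b, f b a = -f a b) {T : Set V}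
    (h : ∀ (v : V) (c : G.Walk v v), c.IsCycle → (∀ x ∈ c.support, x ∈ T) → c.IsChordless →
      walkSum f c = 0)
    {c : G.Walk v v} (hc : c.IsCycle) (hT : ∀ x ∈ c.support, x ∈ T) : walkSum f c = 0 := by
  induction hn : c.length using Nat.strong_induction_on generalizing v with
  | _ n ih =>
    by_cases hchord : c.IsChordless
    · exact h v c hc hT hchord
    · rw [Walk.IsChordless] at hchord
      push Not at hchord
      obtain ⟨⟨a, b⟩, hab⟩ := hchord
      obtain ⟨c₁, c₂, h₁, h₂, hl₁, hl₂, hs₁, hs₂, hsum⟩ :=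
        exists_shorter_isCycle_of_isChord hf hc hab
      rw [hsum, ih _ (hn ▸ hl₁) h₁ (fun x hx => hT x (hs₁ hx)) rfl,
        ih _ (hn ▸ hl₂) h₂ (fun x hx => hT x (hs₂ hx)) rfl, add_zero]

end WalkSum

section Acyclic

open SimpleGraph

variable {V : Type*} {G : SimpleGraph V} {v : V}

theorem exists_walk_notMem_support_of_isCycle {c : G.Walk v v} (hc : c.IsCycle) {x : V}
    (hx : x ∈ c.support) :
    ∃ a b, a ≠ b ∧ G.Adj x a ∧ G.Adj x b ∧ ∃ r : G.Walk a b, x ∉ r.support ∧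
      r.support ⊆ c.support := by
  classical
  have hsupp : (c.rotate x hx).support ⊆ c.support := fun z => (c.mem_support_rotate_iff x hx).1
  replace hc := hc.rotate hx
  generalize c.rotate x hx = d at hc hsupp
  cases d with
  | nil => exact absurd .nil hc.not_nil
  | @cons _ a _ h p =>
    have hp : ¬ p.Nil := Walk.not_nil_of_ne h.ne'
    have hpath : p.IsPath := ((Walk.cons_isCycle_iff p h).1 hc).1
    have hconcat := p.concat_dropLast (p.adj_penultimate hp)
    rw [← hconcat, Walk.concat_isPath_iff] at hpath
    refine ⟨a, p.penultimate, ?_, h, (p.adj_penultimate hp).symm, p.dropLast, hpath.2, ?_⟩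
    · simpa [Walk.penultimate_cons_of_not_nil _ _ hp] using hc.snd_ne_penultimate
    · intro z hz
      refine hsupp (List.mem_cons_of_mem _ ?_)
      rw [← hconcat, Walk.support_concat]
      exact List.mem_append_left _ hz

theorem eq_of_adj_of_dist_lt (hG : G.IsAcyclic) {o a b : V} (ho : G.Reachable o v)
    (ha : G.Adj a v) (hb : G.Adj b v) (hda : G.dist o a < G.dist o v)
    (hdb : G.dist o b < G.dist o v) : a = b := by
  classical
  have hpath : ∀ {a}, G.Adj a v → G.dist o a < G.dist o v →
      ∃ p : G.Walk o v, p.IsPath ∧ p.penultimate = a := by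
    intro a ha hda
    obtain ⟨p, hp, hlen⟩ := (ho.trans ha.symm.reachable).exists_path_of_dist
    refine ⟨p.concat ha, (Walk.concat_isPath_iff ha).2 ⟨hp, fun hv => ?_⟩,
      p.penultimate_concat ha⟩
    have := dist_le (p.takeUntil v hv)
    have := p.length_takeUntil_le_length hv
    omega
  obtain ⟨p, hp, rfl⟩ := hpath ha hda
  obtain ⟨q, hq, rfl⟩ := hpath hb hdb
  exact congrArg (fun r : G.Path o v => r.1.penultimate)
    ((hG.subsingleton_path o v).elim ⟨p, hp⟩ ⟨q, hq⟩)

end Acyclic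

/-! ### Summation by parts on the triangular lattice -/

theorem unitVec_add_unitVec (w : Wall) : unitVec w + unitVec (w + 2) = unitVec (w + 1) := by
  fin_cases w <;> rfl

theorem hexGraph_adj_unitVec (c : Cell) (w : Wall) :
    hexGraph.Adj (c + unitVec w) (c + unitVec (w + 1)) :=
  ⟨w + 2, by rw [add_assoc, unitVec_add_unitVec]⟩

section Circulation

variable {M : Type*} [AddCommGroup M]

/-- The sum of a 1-cochain `f` around the triangle formed by `c` and its neighbours at the walls
`w` and `w + 1`, counter-clockwise. -/
def circulation (f : Cell → Cell → M) (c : Cell) (w : Wall) : M :=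
  f c (c + unitVec w) + f (c + unitVec w) (c + unitVec (w + 1)) + f (c + unitVec (w + 1)) c

theorem circulation_sub_coboundary (f : Cell → Cell → M) (φ : Cell → M) (c : Cell) (w : Wall) :
    circulation (fun a b => f a b - (φ b - φ a)) c w = circulation f c w := by
  simp only [circulation]
  abel

theorem finsum_shift (f : Cell → Cell → M) (u v : Cell) :
    ∑ᶠ c, f (c + u) (c + u + v) = ∑ᶠ c, f c (c + v) :=
  finsum_comp_equiv (Equiv.addRight u) (f := fun c => f c (c + v))

theorem finite_support_shift {f : Cell → Cell → M} {v : Cell}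
    (h : (Function.support fun c => f c (c + v)).Finite) (u : Cell) :
    (Function.support fun c => f (c + u) (c + u + v)).Finite :=
  h.preimage (add_left_injective u).injOn

theorem finsum_circulation {f : Cell → Cell → M}
    (hfin : ∀ v, (Function.support fun c => f c (c + v)).Finite) (w : Wall) :
    ∑ᶠ c, circulation f c w = ∑ᶠ c, f c (c + unitVec w) + ∑ᶠ c, f c (c + unitVec (w + 2)) +
      ∑ᶠ c, f c (c + unitVec (w + 4)) := by
  have hback : unitVec (w + 1) + unitVec (w + 4) = 0 := by fin_cases w <;> rfl
  have hterm (c : Cell) : circulation f c w = f c (c + unitVec w) +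
      f (c + unitVec w) (c + unitVec w + unitVec (w + 2)) +
        f (c + unitVec (w + 1)) (c + unitVec (w + 1) + unitVec (w + 4)) := by
    rw [circulation, add_assoc c, unitVec_add_unitVec, add_assoc c, hback, add_zero]
  have h₁ := hfin (unitVec w)
  have h₂ := finite_support_shift (hfin (unitVec (w + 2))) (unitVec w)
  have h₃ := finite_support_shift (hfin (unitVec (w + 4))) (unitVec (w + 1))
  rw [finsum_congr hterm, finsum_add_distrib ((h₁.union h₂).subset (Function.support_add _ _)) h₃,
    finsum_add_distrib h₁ h₂, finsum_shift, finsum_shift]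

-- Every edge lies in one triangle of each of the two kinds, which traverse it in opposite
-- directions.
theorem finsum_circulation_add {f : Cell → Cell → M} (hf : ∀ a b, f b a = -f a b)
    (hfin : ∀ v, (Function.support fun c => f c (c + v)).Finite) (w : Wall) :
    ∑ᶠ c, circulation f c (w + 1) + ∑ᶠ c, circulation f c w = 0 := by
  have hneg (k : Wall) : ∑ᶠ c, f c (c + unitVec (k + 3)) = -∑ᶠ c, f c (c + unitVec k) := by
    rw [unitVec_opposite, ← finsum_shift f (unitVec k), ← finsum_neg_distrib]
    exact finsum_congr fun c => by rw [add_neg_cancel_right, hf]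
  rw [finsum_circulation hfin, finsum_circulation hfin, show w + 1 + 2 = w + 3 by abel,
    show w + 1 + 4 = w + 2 + 3 by abel, show w + 4 = w + 1 + 3 by abel, hneg, hneg, hneg]
  abel

/-- The 1-cochain `f` restricted to the pairs that meet `A`. -/
def cutoff (A : Finset Cell) (f : Cell → Cell → M) (a b : Cell) : M :=
  if a ∈ A ∨ b ∈ A then f a b else 0

theorem finite_support_cutoff (A : Finset Cell) (f : Cell → Cell → M) (v : Cell) :
    (Function.support fun c => cutoff A f c (c + v)).Finite := by
  refine (A.finite_toSet.union (A.finite_toSet.preimage (add_left_injective v).injOn)).subset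
    fun c hc => ?_
  by_contra h
  exact hc (if_neg h)

section Surrounded

variable {A B : Finset Cell} {f : Cell → Cell → M}

theorem cutoff_eq_of_mem (hA : ∀ a ∈ A, ∀ b, hexGraph.Adj a b → b ∈ A ∨ b ∈ B)
    (hB : ∀ a ∈ B, ∀ b ∈ B, hexGraph.Adj a b → f a b = 0) {a b d : Cell}
    (hab : hexGraph.Adj a b) (hbd : hexGraph.Adj b d) (hda : hexGraph.Adj d a)
    (h : a ∈ A ∨ b ∈ A ∨ d ∈ A) : cutoff A f a b = f a b := by
  by_cases h' : a ∈ A ∨ b ∈ A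
  · exact if_pos h'
  · have hd : d ∈ A := by tauto
    rw [not_or] at h'
    exact (if_neg (not_or.2 h')).trans (hB a ((hA d hd a hda).resolve_left h'.1) b
      ((hA d hd b hbd.symm).resolve_left h'.2) hab).symm

theorem circulation_cutoff (hA : ∀ a ∈ A, ∀ b, hexGraph.Adj a b → b ∈ A ∨ b ∈ B)
    (hB : ∀ a ∈ B, ∀ b ∈ B, hexGraph.Adj a b → f a b = 0) (c : Cell) (w : Wall) :
    circulation (cutoff A f) c w =
      if c ∈ A ∨ c + unitVec w ∈ A ∨ c + unitVec (w + 1) ∈ A then circulation f c w else 0 := by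
  have h₁ : hexGraph.Adj c (c + unitVec w) := ⟨w, rfl⟩
  have h₂ := hexGraph_adj_unitVec c w
  have h₃ : hexGraph.Adj (c + unitVec (w + 1)) c := SimpleGraph.Adj.symm ⟨w + 1, rfl⟩
  split_ifs with h
  · rw [circulation, cutoff_eq_of_mem hA hB h₁ h₂ h₃ h,
      cutoff_eq_of_mem hA hB h₂ h₃ h₁ (by tauto), cutoff_eq_of_mem hA hB h₃ h₁ h₂ (by tauto),
      circulation]
  · rw [circulation, cutoff, cutoff, cutoff, if_neg (by tauto), if_neg (by tauto),
      if_neg (by tauto), add_zero, add_zero]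

theorem finsum_circulation_of_surrounded (hf : ∀ a b, f b a = -f a b)
    (hA : ∀ a ∈ A, ∀ b, hexGraph.Adj a b → b ∈ A ∨ b ∈ B)
    (hB : ∀ a ∈ B, ∀ b ∈ B, hexGraph.Adj a b → f a b = 0) (w : Wall) :
    (∑ᶠ c, if c ∈ A ∨ c + unitVec (w + 1) ∈ A ∨ c + unitVec (w + 1 + 1) ∈ A then
        circulation f c (w + 1) else 0) +
      (∑ᶠ c, if c ∈ A ∨ c + unitVec w ∈ A ∨ c + unitVec (w + 1) ∈ A then
        circulation f c w else 0) = 0 := by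
  have hcut (a b : Cell) : cutoff A f b a = -cutoff A f a b := by
    simp only [cutoff, hf a b, or_comm]
    split_ifs <;> simp
  simpa only [circulation_cutoff hA hB] using
    finsum_circulation_add hcut (finite_support_cutoff A f) w

end Surrounded

end Circulation

/-! ### Crossing parity -/

instance (y a b : Cell) : Decidable (UpCrossing y a b) :=
  inferInstanceAs (Decidable (_ ∧ _ ∧ _))

/-- The parity of the number of crossings of the edge `a b` with the ray that starts at `y`. -/
def crossing (y a b : Cell) : ZMod 2 :=
  if UpCrossing y a b ∨ UpCrossing y b a then 1 else 0

theorem crossing_swap (y a b : Cell) : crossing y b a = -crossing y a b := by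
  rw [CharTwo.neg_eq]
  exact if_congr Or.comm rfl rfl

theorem crossing_mk (r s p q p' q' : ℤ) : crossing (r, s) (p, q) (p', q') =
    if (2 * q + p ≤ 2 * s + r ∧ 2 * s + r < 2 * q' + p' ∧ p < r) ∨
      (2 * q' + p' ≤ 2 * s + r ∧ 2 * s + r < 2 * q + p ∧ p' < r) then 1 else 0 :=
  if_congr Iff.rfl rfl rfl

theorem walkSum_crossing (y : Cell) {v : Cell} (c : hexGraph.Walk v v) :
    walkSum (crossing y) c = crossingNumber c y := by
  rw [walkSum, crossingNumber]
  induction c.darts with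
  | nil => simp
  | cons d l ih =>
    rw [List.map_cons, List.sum_cons, ih, List.countP_cons, Nat.cast_add, add_comm]
    by_cases h : UpCrossing y d.fst d.snd ∨ UpCrossing y d.snd d.fst <;> simp [crossing, h]

theorem walkSum_crossing_ne_zero_iff (y : Cell) {v : Cell} (c : hexGraph.Walk v v) :
    walkSum (crossing y) c ≠ 0 ↔ Odd (crossingNumber c y) := by
  rw [walkSum_crossing, Ne, ZMod.natCast_eq_zero_iff_even, Nat.not_even_iff_odd]

theorem hexGraph_adj_iff {a b : Cell} : hexGraph.Adj a b ↔
    (b.1 = a.1 ∧ (b.2 = a.2 + 1 ∨ b.2 = a.2 - 1)) ∨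
    (b.1 = a.1 - 1 ∧ (b.2 = a.2 + 1 ∨ b.2 = a.2)) ∨
    (b.1 = a.1 + 1 ∧ (b.2 = a.2 - 1 ∨ b.2 = a.2)) := by
  obtain ⟨p, q⟩ := a
  obtain ⟨r, s⟩ := b
  change (∃ w : Wall, _) ↔ _
  simp only [Fin.exists_fin_succ, unitVec, Prod.ext_iff, Prod.mk_add_mk, Int.reduceNeg,
    Matrix.cons_val_zero, Matrix.cons_val_succ, Matrix.cons_val_fin_one, add_zero,
    IsEmpty.exists_iff, or_false]
  omega

theorem circulation_crossing_five (y c : Cell) :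
    circulation (crossing y) c 5 = if c = y - unitVec 5 then 1 else 0 := by
  obtain ⟨p, q⟩ := c
  obtain ⟨r, s⟩ := y
  have hy : ((p, q) : Cell) = (r, s) - unitVec 5 ↔ p = r - 1 ∧ q = s - 0 := Prod.mk_inj
  change crossing (r, s) (p, q) (p + 1, q + 0) + crossing (r, s) (p + 1, q + 0) (p + 0, q + 1) +
    crossing (r, s) (p + 0, q + 1) (p, q) = _
  simp only [hy, crossing_mk]
  split_ifs <;> first | decide | omega

theorem circulation_crossing_four (y c : Cell) : circulation (crossing y) c 4 = 0 := by
  obtain ⟨p, q⟩ := c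
  obtain ⟨r, s⟩ := y
  change crossing (r, s) (p, q) (p + 1, q + -1) + crossing (r, s) (p + 1, q + -1) (p + 1, q + 0) +
    crossing (r, s) (p + 1, q + 0) (p, q) = 0
  simp only [crossing_mk]
  split_ifs <;> first | decide | omega

-- Of the triangles, only the one that has `y` as its rightmost corner has an odd number of
-- crossings.
theorem crossing_ne_coboundary_of_surrounded {A B : Finset Cell} {x : Cell}
    (hA : ∀ a ∈ A, ∀ b, hexGraph.Adj a b → b ∈ A ∨ b ∈ B) (hx : x ∈ A) (φ : Cell → ZMod 2) :
    ∃ a ∈ B, ∃ b ∈ B, hexGraph.Adj a b ∧ crossing x a b ≠ φ b - φ a := by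
  by_contra! hφ
  have hstokes := finsum_circulation_of_surrounded (f := fun a b => crossing x a b - (φ b - φ a))
    (fun a b => by rw [crossing_swap]; abel) hA
    (fun a ha b hb hab => sub_eq_zero.2 (hφ a ha b hb hab)) 4
  have hone (c : Cell) : (if c ∈ A ∨ c + unitVec 5 ∈ A ∨ c + unitVec 0 ∈ A then
      circulation (crossing x) c 5 else 0) = if c = x - unitVec 5 then 1 else 0 := by
    rw [circulation_crossing_five]
    split_ifs with h hc hc <;> first | rfl | skip
    exact absurd (.inr (.inl (by rwa [hc, sub_add_cancel]))) h
  simp only [circulation_sub_coboundary] at hstokes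
  simp only [circulation_crossing_four, ite_self, finsum_zero, add_zero] at hstokes
  have hsum := (finsum_congr hone).symm.trans hstokes
  rw [finsum_eq_single _ (x - unitVec 5) fun c hc => if_neg hc, if_pos rfl] at hsum
  exact one_ne_zero hsum

theorem exists_isMinimalCycle_of_odd {B : Finset Cell} {x : Cell} (hx : x ∉ B)
    {v : Cell} {c : hexGraph.Walk v v} (hc : c.IsCycle) (hB : ∀ z ∈ c.support, z ∈ B)
    (hodd : walkSum (crossing x) c ≠ 0) :
    ∃ (u : Cell) (d : hexGraph.Walk u u), IsMinimalCycle B d ∧ Encloses d x := by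
  by_contra! hno
  refine hodd (walkSum_eq_zero_of_forall_isChordless (crossing_swap x) (T := B)
    (fun u d hd hdB hmin => ?_) hc hB)
  by_contra hne
  exact hno u d ⟨hd, hdB, fun a ha b hb => hmin.mem_edges ha hb⟩
    ⟨fun h => hx (hdB x h), (walkSum_crossing_ne_zero_iff x d).1 hne⟩

theorem targetOf_perimeter {S : Finset Cell} (hS : HoleFree S) :
    targetOf (perimeter S) = (S : Set Cell) := by
  have hsub {z : Cell} (hz : z ∈ perimeter S) : z ∈ S := (Finset.mem_filter.1 hz).1
  refine Set.Subset.antisymm ?_ fun x hxS => or_iff_not_imp_left.2 fun hxB => ?_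
  · rintro x (h | ⟨v, c, hc, hx⟩)
    · exact hsub h
    · exact hS v c hc.1 (fun z hz => hsub (hc.2.1 z hz)) x hx
  · by_contra hno
    obtain ⟨φ, hφ⟩ := exists_potential_on (T := perimeter S) (crossing_swap x)
      fun v c hc hcB => of_not_not fun h => hno (exists_isMinimalCycle_of_odd hxB hc hcB h)
    have hsurr : ∀ a ∈ S \ perimeter S, ∀ b, hexGraph.Adj a b →
        b ∈ S \ perimeter S ∨ b ∈ perimeter S := by
      rintro a ha b ⟨w, rfl⟩
      rw [Finset.mem_sdiff] at ha
      have hbS : a + unitVec w ∈ S :=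
        of_not_not fun h => ha.2 (Finset.mem_filter.2 ⟨ha.1, w, h⟩)
      by_cases hb : a + unitVec w ∈ perimeter S
      · exact .inr hb
      · exact .inl (Finset.mem_sdiff.2 ⟨hbS, hb⟩)
    obtain ⟨a, ha, b, hb, hab, hne⟩ := crossing_ne_coboundary_of_surrounded hsurr
      (Finset.mem_sdiff.2 ⟨hxS, hxB⟩) φ
    exact hne (hφ a ha b hb hab)

theorem HoleFree.exists_potential {S : Finset Cell} (hS : HoleFree S) {y : Cell} (hy : y ∉ S) :
    ∃ φ : Cell → ZMod 2, ∀ a ∈ S, ∀ b ∈ S, hexGraph.Adj a b → crossing y a b = φ b - φ a :=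
  exists_potential_on (T := S) (crossing_swap y) fun v c hc hcS => by
    by_contra hne
    exact hy (hS v c hc hcS y ⟨fun h => hy (hcS y h), (walkSum_crossing_ne_zero_iff y c).1 hne⟩)

/-! ### Column segments -/

/-- The maximal run of consecutive positions of `S` in the column of `x` that contains `x`,
given by its column and its set of rows. -/
def seg (S : Finset Cell) (x : Cell) : ℤ × Set ℤ :=
  (x.1, {q | ∀ k ∈ Set.uIcc q x.2, (x.1, k) ∈ S})

section Segments

variable {S : Finset Cell} {x y z : Cell}

theorem column_eq_of_seg_eq (h : seg S x = seg S y) : x.1 = y.1 :=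
  (Prod.ext_iff.1 h).1

theorem seg_eq_iff (hx : x ∈ S) :
    seg S x = seg S y ↔ x.1 = y.1 ∧ ∀ k ∈ Set.uIcc x.2 y.2, (x.1, k) ∈ S := by
  obtain ⟨p, q⟩ := x
  obtain ⟨r, s⟩ := y
  simp only [seg, Prod.mk.injEq]
  refine and_congr_right ?_
  rintro rfl
  refine ⟨fun h => (Set.ext_iff.1 h q).1 fun k hk => ?_, fun h => Set.ext fun t => ⟨?_, ?_⟩⟩
  · rwa [Set.uIcc_self.subset hk]
  · exact fun ht k hk => (Set.uIcc_subset_uIcc_union_uIcc hk).elim (ht k) (h k)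
  · exact fun ht k hk => (Set.uIcc_subset_uIcc_union_uIcc hk).elim (ht k) fun hk =>
      h k (by rwa [Set.uIcc_comm])

theorem seg_eq_of_mem_uIcc (hx : x ∈ S) (h : seg S x = seg S y) {k : ℤ}
    (hk : k ∈ Set.uIcc x.2 y.2) : (x.1, k) ∈ S ∧ seg S (x.1, k) = seg S x := by
  have hS := ((seg_eq_iff hx).1 h).2
  exact ⟨hS k hk, Eq.symm <| (seg_eq_iff hx).2 ⟨rfl, fun j hj =>
    hS j (Set.uIcc_subset_uIcc_left hk hj)⟩⟩

theorem mem_seg_iff {k : ℤ} :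
    k ∈ (seg S x).2 ↔ (x.1, k) ∈ S ∧ seg S (x.1, k) = seg S x := by
  refine ⟨fun h => ?_, fun ⟨hk, h⟩ => ((seg_eq_iff hk).1 h).2⟩
  have hk : (x.1, k) ∈ S := h k Set.left_mem_uIcc
  exact ⟨hk, (seg_eq_iff hk).2 ⟨rfl, h⟩⟩

theorem ordConnected_seg (S : Finset Cell) (x : Cell) : (seg S x).2.OrdConnected := by
  refine ⟨fun a ha b hb k hk => ?_⟩
  rw [mem_seg_iff] at ha hb ⊢
  have hkS := seg_eq_of_mem_uIcc ha.1 (ha.2.trans hb.2.symm) (Set.Icc_subset_uIcc hk)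
  exact ⟨hkS.1, hkS.2.trans ha.2⟩

theorem row_lt_of_notMem (hx : x ∈ S) (h : seg S x = seg S y) {k : ℤ} (hk : (x.1, k) ∉ S) :
    (x.2 < k → y.2 < k) ∧ (k < x.2 → k < y.2) := by
  have hno : k ∉ Set.uIcc x.2 y.2 := fun h' => hk (seg_eq_of_mem_uIcc hx h h').1
  rw [Set.mem_uIcc] at hno
  omega

theorem exists_notMem_of_seg_ne (hx : x ∈ S) (hy : y ∈ S) (hc : x.1 = y.1) (hle : x.2 ≤ y.2)
    (hne : seg S x ≠ seg S y) : ∃ s, x.2 < s ∧ s < y.2 ∧ (x.1, s) ∉ S := by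
  by_contra! hno
  refine hne ((seg_eq_iff hx).2 ⟨hc, fun k hk => ?_⟩)
  rw [Set.uIcc_of_le hle] at hk
  rcases hk.1.eq_or_lt with rfl | hxk
  · exact hx
  rcases hk.2.eq_or_lt with rfl | hky
  · rwa [hc]
  · exact hno k hxk hky

theorem seg_eq_of_close (hx : x ∈ S) (hy : y ∈ S) (hc : x.1 = y.1)
    (hxy : x.2 ≤ y.2 + 1) (hyx : y.2 ≤ x.2 + 1) : seg S x = seg S y := by
  by_contra hne
  rcases le_total x.2 y.2 with hle | hle
  · obtain ⟨s, hxs, hsy, -⟩ := exists_notMem_of_seg_ne hx hy hc hle hne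
    omega
  · obtain ⟨s, hys, hsx, -⟩ := exists_notMem_of_seg_ne hy hx hc.symm hle (Ne.symm hne)
    omega

theorem row_close_of_adj (hy : hexGraph.Adj x y) (hz : hexGraph.Adj x z) (hc : y.1 = z.1)
    (hx : x.1 ≠ y.1) : y.2 ≤ z.2 + 1 ∧ z.2 ≤ y.2 + 1 := by
  rw [hexGraph_adj_iff] at hy hz
  omega

theorem seg_eq_of_adj (hx : x ∈ S) (hy : y ∈ S) (h : hexGraph.Adj x y) (hc : x.1 = y.1) :
    seg S x = seg S y := by
  rw [hexGraph_adj_iff] at h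
  exact seg_eq_of_close hx hy hc (by omega) (by omega)

theorem seg_eq_of_adj_of_adj (hy : y ∈ S) (hz : z ∈ S) (hxy : hexGraph.Adj x y)
    (hxz : hexGraph.Adj x z) (hc : y.1 = z.1) (hx : x.1 ≠ y.1) : seg S y = seg S z :=
  have hclose := row_close_of_adj hxy hxz hc hx
  seg_eq_of_close hy hz hc hclose.1 hclose.2

theorem eq_of_seg_eq {α : Type*} {φ : Cell → α} (hx : x ∈ S) (h : seg S x = seg S y)
    (hφ : ∀ u ∈ S, ∀ v ∈ S, hexGraph.Adj u v → seg S u = seg S x → seg S v = seg S x → φ u = φ v) :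
    φ x = φ y := by
  wlog hle : x.2 ≤ y.2 generalizing x y
  · have hy : y ∈ S := by
      have := (seg_eq_of_mem_uIcc hx h Set.right_mem_uIcc).1
      rwa [column_eq_of_seg_eq h] at this
    exact (this hy h.symm (by rwa [h] at hφ) (not_le.1 hle).le).symm
  have hrun : ∀ k, x.2 ≤ k → k ≤ y.2 → φ x = φ (x.1, k) := by
    intro k hk
    induction k, hk using Int.leInduction with
    | base => exact fun _ => rfl
    | succ k hk ih =>
      intro hky
      have hk₀ := seg_eq_of_mem_uIcc hx h (Set.mem_uIcc_of_le hk (by omega))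
      have hk₁ := seg_eq_of_mem_uIcc hx h (Set.mem_uIcc_of_le (a := x.2) (by omega) hky)
      exact (ih (by omega)).trans
        (hφ _ hk₀.1 _ hk₁.1 (hexGraph_adj_iff.2 (.inl ⟨rfl, .inl rfl⟩)) hk₀.2 hk₁.2)
  rw [hrun y.2 hle le_rfl, column_eq_of_seg_eq h]

end Segments

/-- The adjacency graph of the column segments of `S`. -/
def segGraph (S : Finset Cell) : SimpleGraph (ℤ × Set ℤ) where
  Adj a b := a ≠ b ∧ ∃ x ∈ S, ∃ y ∈ S, hexGraph.Adj x y ∧ seg S x = a ∧ seg S y = b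
  symm := ⟨fun _ _ ⟨hne, x, hx, y, hy, h, hxa, hyb⟩ => ⟨hne.symm, y, hy, x, hx, h.symm, hyb, hxa⟩⟩
  loopless := ⟨fun _ h => h.1 rfl⟩

section Forest

variable {S : Finset Cell} {x y : Cell}

theorem segGraph_adj_of_adj (hx : x ∈ S) (hy : y ∈ S) (h : hexGraph.Adj x y) (hc : x.1 ≠ y.1) :
    (segGraph S).Adj (seg S x) (seg S y) :=
  ⟨fun h' => hc (column_eq_of_seg_eq h'), x, hx, y, hy, h, rfl, rfl⟩

theorem segGraph_adj_column {a b : ℤ × Set ℤ} (h : (segGraph S).Adj a b) :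
    b.1 = a.1 + 1 ∨ b.1 = a.1 - 1 := by
  obtain ⟨hne, x, hx, y, hy, hxy, rfl, rfl⟩ := h
  have hc : x.1 ≠ y.1 := fun hc => hne (seg_eq_of_adj hx hy hxy hc)
  rw [hexGraph_adj_iff] at hxy
  change y.1 = x.1 + 1 ∨ y.1 = x.1 - 1
  omega

theorem eq_of_segGraph_walk {α : Type*} {φ : Cell → α} {C : Set (ℤ × Set ℤ)}
    (hφ : ∀ u ∈ S, ∀ v ∈ S, hexGraph.Adj u v → seg S u ∈ C → seg S v ∈ C → φ u = φ v)
    {A B : ℤ × Set ℤ} (r : (segGraph S).Walk A B) (hr : ∀ T ∈ r.support, T ∈ C)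
    (hx : x ∈ S) (hxA : seg S x = A) (hyB : seg S y = B) : φ x = φ y := by
  have hseg {u v : Cell} (hu : u ∈ S) (huC : seg S u ∈ C) (huv : seg S u = seg S v) : φ u = φ v :=
    eq_of_seg_eq hu huv fun a ha b hb hab hau hbu =>
      hφ a ha b hb hab (by rwa [hau]) (by rwa [hbu])
  induction r generalizing x with
  | nil => exact hseg hx (hxA ▸ hr _ (by simp)) (hxA.trans hyB.symm)
  | cons h r ih =>
    simp only [SimpleGraph.Walk.support_cons, List.mem_cons, forall_eq_or_imp] at hr
    obtain ⟨-, u, hu, v, hv, huv, rfl, rfl⟩ := h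
    calc φ x = φ u := hseg hx (by rw [hxA]; exact hr.1) hxA
      _ = φ v := hφ u hu v hv huv hr.1 (hr.2 _ r.start_mem_support)
      _ = φ y := ih hr.2 hv rfl hyB

theorem crossing_of_column {p s : ℤ} (h : hexGraph.Adj x y) (hx : x.1 = p) (hy : y.1 = p) :
    crossing (p + 1, s) x y = (if s < y.2 then 1 else 0) - (if s < x.2 then 1 else 0) := by
  obtain ⟨p', q⟩ := x
  obtain ⟨p', q'⟩ := y
  simp only [hexGraph_adj_iff] at h hx hy
  rw [crossing_mk]
  split_ifs <;> first | decide | omega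

theorem crossing_eq_zero {p s : ℤ} (h : hexGraph.Adj x y) (hx : p ≤ x.1) (hy : p ≤ y.1)
    (hne : ¬ (x.1 = p ∧ y.1 = p ∧ s ≤ x.2 ∧ x.2 ≤ s + 1)) : crossing (p + 1, s) x y = 0 := by
  obtain ⟨p', q⟩ := x
  obtain ⟨p', q'⟩ := y
  simp only [hexGraph_adj_iff] at h hx hy hne
  rw [crossing_mk, if_neg]
  omega

-- A position outside `S` between `a` and `b` would have to be encircled: a potential for its
-- crossing parity is constant along the walk but changes once along the segment of `a'`.
theorem HoleFree.seg_eq_of_walk (hS : HoleFree S) {a a' b b' : Cell} (ha : a ∈ S) (ha' : a' ∈ S)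
    (hb : b ∈ S) (hb' : b' ∈ S) (haa : hexGraph.Adj a a') (hbb : hexGraph.Adj b b')
    (hab' : seg S a' = seg S b') (hca : a.1 = a'.1 + 1) (hcb : b.1 = b'.1 + 1) (hle : a.2 ≤ b.2)
    (r : (segGraph S).Walk (seg S a) (seg S b))
    (hr : ∀ T ∈ r.support, T ≠ seg S a' ∧ a'.1 ≤ T.1) : seg S a = seg S b := by
  by_contra hab
  have hc' := column_eq_of_seg_eq hab'
  obtain ⟨s, has, hsb, hsS⟩ := exists_notMem_of_seg_ne ha hb (by omega) hle hab
  rw [hca] at hsS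
  have haa_rows := hexGraph_adj_iff.1 haa
  have hbb_rows := hexGraph_adj_iff.1 hbb
  obtain ⟨φ, hφ⟩ := hS.exists_potential hsS
  have hφ_eq {u v : Cell} (hu : u ∈ S) (hv : v ∈ S) (huv : hexGraph.Adj u v) (hpu : a'.1 ≤ u.1)
      (hpv : a'.1 ≤ v.1) (hne : seg S u ≠ seg S a' ∨ v.1 ≠ a'.1) : φ u = φ v := by
    refine (sub_eq_zero.1 ((hφ u hu v hv huv).symm.trans (crossing_eq_zero huv hpu hpv ?_))).symm
    rintro ⟨hpu, hpv, hsu, hus⟩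
    refine hne.elim (fun h => h ?_) fun h => h hpv
    rw [← Prod.mk.eta (p := u), hpu]
    exact (seg_eq_of_mem_uIcc ha' hab' (Set.mem_uIcc_of_le (by omega) (by omega))).2
  have hwalk : φ a = φ b := eq_of_segGraph_walk (C := {T | T ≠ seg S a' ∧ a'.1 ≤ T.1})
    (fun u hu v hv huv hTu hTv => hφ_eq hu hv huv hTu.2 hTv.2 (.inl hTu.1)) r hr ha rfl rfl
  have haa' : φ a' = φ a := hφ_eq ha' ha haa.symm le_rfl (by omega) (.inr (by omega))
  have hbb' : φ b' = φ b := hφ_eq hb' hb hbb.symm (by omega) (by omega) (.inr (by omega))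
  have hcol := eq_of_seg_eq (φ := fun u => φ u - if s < u.2 then 1 else 0) ha' hab'
    fun u hu v hv huv hua hva => by
      have hcross := hφ u hu v hv huv
      rw [crossing_of_column huv (column_eq_of_seg_eq hua) (column_eq_of_seg_eq hva)] at hcross
      linear_combination hcross
  rw [if_neg (by omega), if_pos (by omega), haa', hbb', hwalk] at hcol
  exact one_ne_zero (sub_eq_self.1 (hcol.symm.trans (sub_zero _)))

theorem HoleFree.segGraph_isAcyclic (hS : HoleFree S) : (segGraph S).IsAcyclic := by
  classical
  intro v c hc
  obtain ⟨Q, hQ, hmin⟩ := c.support.toFinset.exists_min_image Prod.fst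
    ⟨v, List.mem_toFinset.2 c.start_mem_support⟩
  simp only [List.mem_toFinset] at hQ hmin
  obtain ⟨A, B, hAB, hA, hB, r, hQr, hrc⟩ := exists_walk_notMem_support_of_isCycle hc hQ
  have hr : ∀ T ∈ r.support, T ≠ Q ∧ Q.1 ≤ T.1 := fun T hT =>
    ⟨fun h => hQr (h ▸ hT), hmin T (hrc hT)⟩
  have hcA := segGraph_adj_column hA
  have hcB := segGraph_adj_column hB
  have hQA := (hr A r.start_mem_support).2
  have hQB := (hr B r.end_mem_support).2
  obtain ⟨-, a', ha', a, ha, haa, rfl, rfl⟩ := hA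
  obtain ⟨-, b', hb', b, hb, hbb, hbQ, rfl⟩ := hB
  simp only [seg] at hcA hcB hQA hQB
  have hc := column_eq_of_seg_eq hbQ
  rcases le_total a.2 b.2 with hle | hle
  · exact hAB (hS.seg_eq_of_walk ha ha' hb hb' haa.symm hbb.symm hbQ.symm (by omega) (by omega)
      hle r hr)
  · refine hAB (hS.seg_eq_of_walk hb hb' ha ha' hbb.symm haa.symm hbQ (by omega) (by omega)
      hle r.reverse fun T hT => ?_).symm
    rw [hbQ, hc]
    exact hr T (by simpa using hT)

end Forest

/-! ### Depth -/

/-- The distance of the segment of `x` from the segment of the root robot. -/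
def depth (S : Finset Cell) (x : Cell) : ℕ :=
  (segGraph S).dist (seg S (0, 0)) (seg S x)

/-- The segment of `x` is joined to the segment of the root robot by a chain of segments;
elsewhere `depth` has the junk value `0`. -/
def Joined (S : Finset Cell) (x : Cell) : Prop :=
  (segGraph S).Reachable (seg S (0, 0)) (seg S x)

/-- `v` is a neighbour of `x` in the parent of the segment of `x`, if segments are regarded as the
vertices of a tree with the segment of the root robot as its root. -/
structure Inward (S : Finset Cell) (x v : Cell) : Prop where
  mem : v ∈ S
  adj : hexGraph.Adj x v
  depth_lt : depth S v < depth S x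

section Depth

variable {S : Finset Cell} {x y v w : Cell}

theorem depth_congr (h : seg S x = seg S y) : depth S x = depth S y := by
  rw [depth, depth, h]

theorem Joined.congr (hj : Joined S x) (h : seg S x = seg S y) : Joined S y := by
  rwa [Joined, ← h]

theorem Joined.of_adj (hj : Joined S x) (hx : x ∈ S) (hy : y ∈ S) (h : hexGraph.Adj x y) :
    Joined S y := by
  by_cases hc : x.1 = y.1
  · exact hj.congr (seg_eq_of_adj hx hy h hc)
  · exact hj.trans (segGraph_adj_of_adj hx hy h hc).reachable

theorem not_inward_root : ¬ Inward S (0, 0) v := fun h =>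
  Nat.not_lt_zero _ (h.depth_lt.trans_eq SimpleGraph.dist_self)

theorem Inward.column_ne (h : Inward S x v) (hx : x ∈ S) : x.1 ≠ v.1 := fun hc =>
  h.depth_lt.ne' (depth_congr (seg_eq_of_adj hx h.mem h.adj hc))

theorem Inward.of_adj (h : Inward S x v) (hx : x ∈ S) (hw : w ∈ S) (hxw : hexGraph.Adj x w)
    (hc : w.1 = v.1) : Inward S x w :=
  have hseg := seg_eq_of_adj_of_adj h.mem hw h.adj hxw hc.symm (h.column_ne hx)
  ⟨hw, hxw, (depth_congr hseg).symm.trans_lt h.depth_lt⟩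

theorem HoleFree.inward_or_inward (hS : HoleFree S) (hj : Joined S x) (hx : x ∈ S) (hy : y ∈ S)
    (h : hexGraph.Adj x y) (hc : x.1 ≠ y.1) : Inward S x y ∨ Inward S y x :=
  (hS.segGraph_isAcyclic.dist_ne_of_adj (segGraph_adj_of_adj hx hy h hc) hj).lt_or_gt.symm.imp
    (fun hd => ⟨hy, h, hd⟩) fun hd => ⟨hx, h.symm, hd⟩

theorem Inward.seg_eq (hv : Inward S x v) (hw : Inward S y w) (hS : HoleFree S) (hx : x ∈ S)
    (hy : y ∈ S) (hj : Joined S x) (hxy : seg S x = seg S y) : seg S v = seg S w := by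
  have hadj_v := segGraph_adj_of_adj hx hv.mem hv.adj (hv.column_ne hx)
  have hadj_w := segGraph_adj_of_adj hy hw.mem hw.adj (hw.column_ne hy)
  have hdist_w := hw.depth_lt
  rw [depth, depth, ← hxy] at hdist_w
  rw [← hxy] at hadj_w
  exact eq_of_adj_of_dist_lt hS.segGraph_isAcyclic hj hadj_v.symm hadj_w.symm hv.depth_lt hdist_w

theorem Inward.column_eq (hv : Inward S x v) (hw : Inward S x w) (hS : HoleFree S) (hx : x ∈ S)
    (hj : Joined S x) : v.1 = w.1 :=
  column_eq_of_seg_eq (hv.seg_eq hw hS hx hx hj rfl)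

end Depth

/-! ### Walls and their status -/

theorem mem_walls_iff {F : Flank} {w : Wall} : w ∈ F.walls ↔ (unitVec w).1 = F.dir := by
  cases F <;> fin_cases w <;> decide

theorem mem_foreAft_or_flank (w : Wall) : (w = 0 ∨ w = 3) ∨ ∃ F : Flank, w ∈ F.walls := by
  fin_cases w
  exacts [.inl (.inl rfl), .inr ⟨.left, by decide⟩, .inr ⟨.left, by decide⟩, .inl (.inr rfl),
    .inr ⟨.right, by decide⟩, .inr ⟨.right, by decide⟩]

theorem Flank.dir_injective : Function.Injective Flank.dir := by
  rintro (_ | _) (_ | _) h <;> simp_all [Flank.dir]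

section Status

variable {S : Finset Cell} {X : Finset Cell} {x : Cell} {w : Wall}

theorem status_eq_null_iff (hS : HoleFree S) :
    status (perimeter S) X x w = .null ↔ x + unitVec w ∉ S := by
  rw [status, targetOf_perimeter hS, Finset.mem_coe]
  split_ifs <;> simp_all

theorem status_eq_free_iff (hS : HoleFree S) :
    status (perimeter S) X x w = .free ↔ x + unitVec w ∈ S ∧ x + unitVec w ∉ X := by
  rw [status, targetOf_perimeter hS, Finset.mem_coe]
  split_ifs <;> simp_all

theorem status_eq_occupied_iff (hS : HoleFree S) :
    status (perimeter S) X x w = .occupied ↔ x + unitVec w ∈ S ∧ x + unitVec w ∈ X := by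
  rw [status, targetOf_perimeter hS, Finset.mem_coe]
  split_ifs <;> simp_all

theorem colSegment_perimeter (hS : HoleFree S) (p r : ℤ) :
    colSegment (perimeter S) p r = (seg S (p, r)).2 := by
  simp only [colSegment, targetOf_perimeter hS, Finset.mem_coe, seg]

end Status

/-! ### Nucleation sites -/

/-- A robot at `x` faces the position `y` of an adjacent column, and the two walls next to the one
facing `y` are null; `e` is the row offset of the fore-aft wall among these two. -/
def IsSingleContact (S : Finset Cell) (x y : Cell) : Prop :=
  ∃ e : ℤ, (e = 1 ∨ e = -1) ∧ (x.1, x.2 + e) ∉ S ∧ (y.1, y.2 - e) ∉ S ∧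
    hexGraph.Adj x (y.1, y.2 - e)

/-- The row `r` of a segment `Q₀` is the one that the midpoint rule selects for the adjacent
segment `Q`. -/
def IsSelectedRow (Q Q₀ : Set ℤ) (r : ℤ) : Prop :=
  r = midRow Q ∨ midRow Q ∉ Q₀ ∧ IsNearestConnection Q Q₀ r

/-- The geometric condition behind a nucleation flag of a robot at `x`. -/
def IsNucleationSite (S : Finset Cell) (x : Cell) (F : Flank) : Prop :=
  ∀ y ∈ S, hexGraph.Adj x y → y.1 = x.1 + F.dir →
    IsSingleContact S x y ∨ IsSelectedRow (seg S y).2 (seg S x).2 x.2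

section Nucleation

variable {S : Finset Cell} {F : Flank} {x x' y y' : Cell}

theorem isSelectedRow_of_roleFromColumn (hS : HoleFree S) (hy : y ∈ S) (hxy : hexGraph.Adj x y)
    (hc : y.1 = x.1 + F.dir) (h : roleFromColumn (perimeter S) x F = true) :
    IsSelectedRow (seg S y).2 (seg S x).2 x.2 := by
  simp only [roleFromColumn, decide_eq_true_eq] at h
  obtain ⟨Q, ⟨r, -, rfl⟩, ⟨w, hw, hwQ⟩, h⟩ := h
  rw [colSegment_perimeter hS] at hwQ h
  rw [colSegment_perimeter hS] at h
  obtain ⟨hwS, hseg⟩ := mem_seg_iff.1 hwQ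
  have hcol : (x + unitVec w).1 = x.1 + F.dir := congrArg (x.1 + ·) (mem_walls_iff.1 hw)
  have hwr : (x.1 + F.dir, (x + unitVec w).2) = x + unitVec w := Prod.ext hcol.symm rfl
  rw [hwr] at hwS hseg
  have hx : (x + unitVec w).1 ≠ x.1 := by cases F <;> simp [hcol, Flank.dir]
  rw [← hseg, seg_eq_of_adj_of_adj hwS hy ⟨w, rfl⟩ hxy (hcol.trans hc.symm) hx.symm] at h
  split_ifs at h with hmid hmem
  · exact .inl hmid
  · exact .inr ⟨hmem, h⟩

theorem exists_foreAft_neighbour {w : Wall} (hw : w ∈ F.walls) :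
    ∃ e : ℤ, (e = 1 ∨ e = -1) ∧ ∃ f v : Wall, (f = w - 1 ∨ f = w + 1) ∧ (v = w - 1 ∨ v = w + 1) ∧
      unitVec f = (0, e) ∧ unitVec v = unitVec w - (0, e) := by
  cases F <;> fin_cases hw
  exacts [⟨1, by decide⟩, ⟨-1, by decide⟩, ⟨-1, by decide⟩, ⟨1, by decide⟩]

theorem isSingleContact_of_walls {w : Wall} (hw : w ∈ F.walls)
    (hnull : ∀ v, v = w - 1 ∨ v = w + 1 → x + unitVec v ∉ S) (hy : y ∈ S)
    (hxy : hexGraph.Adj x y) (hc : y.1 = x.1 + F.dir) : IsSingleContact S x y := by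
  obtain ⟨k, rfl⟩ := hxy
  have hk : k ∈ F.walls := mem_walls_iff.2 (add_left_cancel hc)
  have hcase : ∀ F : Flank, ∀ w ∈ F.walls, ∀ k ∈ F.walls, k = w ∨ k = w - 1 ∨ k = w + 1 := by
    rintro (_ | _) <;> decide
  obtain rfl : k = w := (hcase F w hw k hk).resolve_right fun h => hnull k h hy
  obtain ⟨e, he, f, v, hf, hv, hfe, hve⟩ := exists_foreAft_neighbour hw
  have hvx : x + unitVec v = ((x + unitVec k).1, (x + unitVec k).2 - e) := by
    rw [hve, ← add_sub_assoc]
    exact Prod.ext (sub_zero _) rfl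
  have hfx : x + unitVec f = (x.1, x.2 + e) := by
    rw [hfe]
    exact Prod.ext (add_zero _) rfl
  exact ⟨e, he, hfx ▸ hnull f hf, hvx ▸ hnull v hv, v, hvx.symm⟩

theorem isNucleationSite_of_nucleation (hS : HoleFree S) {X : Finset Cell}
    (h : nucleation (perimeter S) (status (perimeter S) X x) x F = true) :
    IsNucleationSite S x F := by
  unfold nucleation roleFromSelf at h
  intro y hy hxy hc
  split_ifs at h with hfree hsingle
  · obtain ⟨w, hw, -, hpred, hsucc⟩ := hsingle
    rw [status_eq_null_iff hS] at hpred hsucc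
    refine .inl (isSingleContact_of_walls hw ?_ hy hxy hc)
    rintro v (rfl | rfl) <;> assumption
  · exact .inr (isSelectedRow_of_roleFromColumn hS hy hxy hc h)

theorem nucleation_eq_false {B : Finset Cell} {s : StatusVec} (h : ∀ w ∈ F.walls, s w ≠ .free) :
    nucleation B s x F = false := by
  have hno : ¬ ∃ w ∈ F.walls, s w = .free := fun ⟨w, hw, hf⟩ => h w hw hf
  simp only [nucleation, roleFromSelf, if_neg hno]

theorem IsSelectedRow.unique {Q Q₀ : Set ℤ} (hQ₀ : Q₀.OrdConnected) {a b : ℤ} (ha : a ∈ Q₀)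
    (hb : b ∈ Q₀) (h : IsSelectedRow Q Q₀ a) (h' : IsSelectedRow Q Q₀ b) : a = b := by
  rcases h with rfl | ⟨hm, haQ, hmin⟩
  · exact h'.elim Eq.symm fun h' => absurd ha h'.1
  rcases h' with rfl | ⟨-, hbQ, hmin'⟩
  · exact absurd hb hm
  have hab := hmin b hbQ
  have hba := hmin' a haQ
  have hnot : ¬ (a ≤ midRow Q ∧ midRow Q ≤ b) := fun h => hm (hQ₀.out ha hb h)
  have hnot' : ¬ (b ≤ midRow Q ∧ midRow Q ≤ a) := fun h => hm (hQ₀.out hb ha h)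
  have habs := abs_cases (a - midRow Q)
  have habs' := abs_cases (b - midRow Q)
  omega

theorem IsSingleContact.eq (h : IsSingleContact S x y) (hx : x ∈ S) (hy : y ∈ S)
    (hxx : seg S x = seg S x') (hyy : seg S y = seg S y') (hxy' : hexGraph.Adj x' y')
    (hc : x.1 ≠ y.1) : x = x' := by
  obtain ⟨e, he, hxe, hye, hadj⟩ := h
  have hcx := column_eq_of_seg_eq hxx
  have hcy := column_eq_of_seg_eq hyy
  have hx' := row_lt_of_notMem hx hxx hxe
  have hy' := row_lt_of_notMem hy hyy hye
  rw [hexGraph_adj_iff] at hxy' hadj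
  exact Prod.ext hcx (by omega)

theorem IsNucleationSite.unique (hx : x ∈ S) (hx' : x' ∈ S) (hy : y ∈ S)
    (hy' : y' ∈ S) (hxx : seg S x = seg S x') (hyy : seg S y = seg S y') (hxy : hexGraph.Adj x y)
    (hxy' : hexGraph.Adj x' y') (hc : y.1 = x.1 + F.dir) (h : IsNucleationSite S x F)
    (h' : IsNucleationSite S x' F) : x = x' := by
  have hcx := column_eq_of_seg_eq hxx
  have hcy := column_eq_of_seg_eq hyy
  have hne : x.1 ≠ y.1 := by cases F <;> simp [hc, Flank.dir]
  rcases h y hy hxy hc with h | h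
  · exact h.eq hx hy hxx hyy hxy' hne
  rcases h' y' hy' hxy' (by omega) with h' | h'
  · exact (h'.eq hx' hy' hxx.symm hyy.symm hxy (by omega)).symm
  rw [← hxx, ← hyy] at h'
  refine Prod.ext hcx (h.unique (ordConnected_seg S x) (mem_seg_iff.2 ⟨hx, rfl⟩) ?_ h')
  rw [hxx]
  exact mem_seg_iff.2 ⟨hx', rfl⟩

/-- The segment of `y` is entered from `x`, the nucleation site in its parent segment, and `y` is
a neighbour of `x`. -/
structure IsSeed (S : Finset Cell) (x y : Cell) : Prop where
  mem : y ∈ S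
  inward : Inward S y x
  exists_flank : ∃ F : Flank, IsNucleationSite S x F ∧ y.1 = x.1 + F.dir

theorem IsSeed.row_close (h : IsSeed S x y) (h' : IsSeed S x y') (hc : y.1 = y'.1) :
    y.2 ≤ y'.2 + 1 ∧ y'.2 ≤ y.2 + 1 :=
  row_close_of_adj h.inward.adj.symm h'.inward.adj.symm hc (h.inward.column_ne h.mem).symm

theorem IsSeed.unique (hS : HoleFree S) (h : IsSeed S x y) (h' : IsSeed S x' y')
    (hj : Joined S y) (hyy : seg S y = seg S y') : x = x' := by
  obtain ⟨hy, hyx, F, hF, hc⟩ := h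
  obtain ⟨hy', hyx', F', hF', hc'⟩ := h'
  have hxx := hyx.seg_eq hyx' hS hy hy' hj hyy
  have hcx := column_eq_of_seg_eq hxx
  have hcy := column_eq_of_seg_eq hyy
  obtain rfl : F = F' := Flank.dir_injective (by omega)
  exact hF.unique hyx.mem hyx'.mem hy hy' hxx hyy hyx.adj.symm hyx'.adj.symm hc hF'

end Nucleation

/-! ### Signals -/

/-- The nucleation flag of a flank. -/
def Memory.flag (m : Memory) : Flank → Bool
  | .left => m.αLeft
  | .right => m.αRight

section Signals

variable {s : StatusVec} {F : Flank} {w : Wall}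

theorem SpecialCondition.exists_occupied (h : SpecialCondition s w) (hw : w ∈ F.walls) :
    ∃ w' ∈ F.walls, s w' = .occupied := by
  have hwalls : (w - 1 ∈ F.walls ∨ w + 1 ∈ F.walls) ∧
      (w - 1 = 0 ∨ w - 1 = 3 → w + 1 ∈ F.walls) ∧ (w + 1 = 0 ∨ w + 1 = 3 → w - 1 ∈ F.walls) := by
    cases F <;> fin_cases hw <;> decide
  obtain ⟨hflank, hsucc, hpred⟩ := hwalls
  rcases h with ⟨hp, hs⟩ | ⟨hf, -, hs⟩ | ⟨hf, -, hp⟩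
  · exact hflank.elim (fun h => ⟨_, h, hp⟩) fun h => ⟨_, h, hs⟩
  · exact ⟨_, hsucc hf, hs⟩
  · exact ⟨_, hpred hf, hp⟩

theorem exists_occupied_or_flag {m : Memory} (h : w ∈ nominalWalls s m.αLeft m.αRight)
    (hw : w ∈ F.walls) :
    (s 0 ≠ .free ∧ s 3 ≠ .free) ∧ ((∃ w' ∈ F.walls, s w' = .occupied) ∨ m.flag F = true) := by
  obtain ⟨-, -, h⟩ := h
  split_ifs at h with hfree
  · exfalso
    rcases h with rfl | rfl <;> cases F <;> revert hw <;> decide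
  refine ⟨not_or.1 hfree, ?_⟩
  have hdisj {F' : Flank} (hw' : w ∈ F'.walls) : F' = F :=
    Flank.dir_injective ((mem_walls_iff.1 hw').symm.trans (mem_walls_iff.1 hw))
  rcases h.2 with h | ⟨hα, hw'⟩ | ⟨hα, hw'⟩
  · exact .inl (h.exists_occupied hw)
  · exact .inr (hdisj hw' ▸ hα)
  · exact .inr (hdisj hw' ▸ hα)

theorem mem_delayedWalls {nb : Wall → StatusVec} {g : ℤ} {f : Wall} (hf : f = 0 ∨ f = 3)
    (hw : w ∈ F.walls) (hfw : w = f - 1 ∨ w = f + 1) (hg : g = -F.dir) (hocc : s w = .occupied)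
    (hfree : nb w f = .free) : f ∈ delayedWalls s nb g := by
  cases F <;> fin_cases hw <;> rcases hf with rfl | rfl <;>
    first | exact absurd hfw (by decide) | simp_all [delayedWalls, Flank.dir]

theorem growthDirection_eq {α : Flank → Bool} (hα : α F = false)
    (hw : ∃ w ∈ F.walls, s w = .occupied)
    (hother : ∀ F' ≠ F, ∀ w ∈ F'.walls, s w ≠ .occupied) :
    growthDirection (α .left) (α .right) s = -F.dir := by
  have hleft := hother .left
  cases F <;> simp_all [growthDirection, Flank.walls, Flank.dir]

end Signals

/-! ### The invariant of executions -/

/-- `X` meets every segment of `S` in an interval. -/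
def IsContiguous (S X : Finset Cell) : Prop :=
  ∀ x ∈ X, ∀ y ∈ X, seg S x = seg S y → ∀ k, x.2 ≤ k → k ≤ y.2 → (x.1, k) ∈ X

/-- The part of the invariant that concerns a single robot at `z` with memory `m`: it sees no
unoccupied position of the parent segment, its own segment is occupied at the nucleation site, it
grows away from the parent segment, and its flags are raised at nucleation sites only. -/
structure IsSettled (S X : Finset Cell) (z : Cell) (m : Memory) : Prop where
  mem_shape : z ∈ S
  joined : Joined S z
  inward_mem : ∀ v, Inward S z v → v ∈ X
  seeded : depth S z ≠ 0 → ∃ x, ∃ y ∈ X, IsSeed S x y ∧ seg S y = seg S z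
  growth : ∀ F : Flank, ∀ v, Inward S z v → v.1 = z.1 + F.dir → m.g = -F.dir
  flag : ∀ F : Flank, m.flag F = true → IsNucleationSite S z F

/-- The invariant of executions: every robot is settled and every segment is occupied in an
interval. -/
structure Invariant (S : Finset Cell) (c : Config) : Prop where
  settled : ∀ z ∈ c.occ, IsSettled S c.occ z (c.mem z)
  contiguous : IsContiguous S c.occ

/-- The properties of an unoccupied position towards which a robot signals. -/
structure IsAttachable (S X : Finset Cell) (n : Cell) : Prop where
  mem_shape : n ∈ S
  joined : Joined S n
  inward_mem : ∀ v, Inward S n v → v ∈ X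
  origin : (∃ m ∈ X, seg S m = seg S n ∧ m.2 ≤ n.2 + 1 ∧ n.2 ≤ m.2 + 1) ∨ ∃ x, IsSeed S x n

section Attachment

variable {S X : Finset Cell} {c : Config} {z n v : Cell} {m : Memory} {F : Flank} {w : Wall}

theorem IsSettled.mono {X' : Finset Cell} (h : IsSettled S X z m) (hX : X ⊆ X') :
    IsSettled S X' z m where
  __ := h
  inward_mem v hv := hX (h.inward_mem v hv)
  seeded hd :=
    have ⟨x, y, hy, hxy⟩ := h.seeded hd
    ⟨x, y, hX hy, hxy⟩

theorem Invariant.inward_of_notMem (hc : Invariant S c) (hS : HoleFree S) (hz : z ∈ c.occ)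
    (hn : n ∈ S) (hnX : n ∉ c.occ) (hzn : hexGraph.Adj z n) (hcol : z.1 ≠ n.1) : Inward S n z :=
  (hS.inward_or_inward (hc.settled z hz).joined (hc.settled z hz).mem_shape hn hzn
    hcol).resolve_left fun h => hnX ((hc.settled z hz).inward_mem n h)

-- The parent segment ends at `v`, so as seen from `z` the nucleation site lies at `v` or beyond it
-- and the nucleated position lies at `n` or beyond it.
theorem Invariant.mem_of_end (hc : Invariant S c) (hS : HoleFree S) {e : ℤ} (he : e = 1 ∨ e = -1)
    (hz : z ∈ c.occ) (hzn : seg S z = seg S n) (hn : n ∈ S) (hne : n.2 = z.2 + e)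
    (hv : Inward S n v) (hzv : ¬ hexGraph.Adj z v) (hend : (v.1, v.2 - e) ∉ S) : n ∈ c.occ := by
  have hd : depth S z ≠ 0 := by
    rw [depth_congr hzn]
    exact Nat.ne_zero_of_lt hv.depth_lt
  obtain ⟨x, y, hy, ⟨hyS, hyx, -⟩, hyz⟩ := (hc.settled z hz).seeded hd
  have hjn := (hc.settled z hz).joined.congr hzn
  have hvx : seg S v = seg S x := hv.seg_eq hyx hS hn hyS hjn (hyz.trans hzn).symm
  have hrow := row_lt_of_notMem hv.mem hvx hend
  have hcx := column_eq_of_seg_eq hvx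
  have hcy := column_eq_of_seg_eq hyz
  have hcn := column_eq_of_seg_eq hzn
  have hcv := hv.column_ne hn
  have hnv := hexGraph_adj_iff.1 hv.adj
  have hyx := hexGraph_adj_iff.1 hyx.adj
  have hzv := mt hexGraph_adj_iff.2 hzv
  rw [← Prod.mk.eta (p := n), ← hcn]
  rcases he with rfl | rfl
  · exact hc.contiguous z hz y hy hyz.symm n.2 (by omega) (by omega)
  · rw [← hcy]
    exact hc.contiguous y hy z hz hyz n.2 (by omega) (by omega)

theorem exists_unitVec_eq_add (hf : (unitVec w).1 = 0) {k : Wall} (hk : (unitVec k).1 ≠ 0)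
    (hpred : k ≠ w - 1) (hsucc : k ≠ w + 1) : ∃ j, unitVec j = unitVec w + unitVec k := by
  revert w k
  decide

theorem Invariant.mem_of_notMem_delayedWalls (hc : Invariant S c) (hS : HoleFree S) {f k : Wall}
    (hf : f = 0 ∨ f = 3) (hz : z ∈ c.occ)
    (hdelay : f ∉ delayedWalls (status (perimeter S) c.occ z)
      (fun w => status (perimeter S) c.occ (z + unitVec w)) (c.mem z).g)
    (hk : k ∈ F.walls) (hkf : k = f - 1 ∨ k = f + 1) (hin : Inward S z (z + unitVec k))
    (hv : z + unitVec k + unitVec f ∈ S) : z + unitVec k + unitVec f ∈ c.occ := by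
  by_contra hvX
  have hg := (hc.settled z hz).growth F _ hin (congrArg (z.1 + ·) (mem_walls_iff.1 hk))
  have hocc := (hc.settled z hz).inward_mem _ hin
  exact hdelay (mem_delayedWalls hf hk hkf hg ((status_eq_occupied_iff hS).2 ⟨hin.mem, hocc⟩)
    ((status_eq_free_iff hS).2 ⟨hv, hvX⟩))

theorem Invariant.inward_mem_of_foreAft (hc : Invariant S c) (hS : HoleFree S) {f : Wall}
    (hf : f = 0 ∨ f = 3) (hz : z ∈ c.occ) (hn : z + unitVec f ∈ S) (hnX : z + unitVec f ∉ c.occ)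
    (hdelay : f ∉ delayedWalls (status (perimeter S) c.occ z)
      (fun w => status (perimeter S) c.occ (z + unitVec w)) (c.mem z).g)
    (hv : Inward S (z + unitVec f) v) : v ∈ c.occ := by
  obtain ⟨hzS, -, hmem, -, -, -⟩ := hc.settled z hz
  obtain ⟨e, he, hfe⟩ : ∃ e : ℤ, (e = 1 ∨ e = -1) ∧ unitVec f = (0, e) := by
    rcases hf with rfl | rfl
    exacts [⟨1, by decide⟩, ⟨-1, by decide⟩]
  have hseg : seg S z = seg S (z + unitVec f) := seg_eq_of_adj hzS hn ⟨f, rfl⟩ (by simp [hfe])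
  have hdepth : depth S z = depth S (z + unitVec f) := depth_congr hseg
  by_cases hzv : hexGraph.Adj z v
  · exact hmem v ⟨hv.mem, hzv, hv.depth_lt.trans_eq hdepth.symm⟩
  have hcol := hv.column_ne hn
  obtain ⟨hvS, ⟨k, rfl⟩, hd⟩ := id hv
  have hk : (unitVec k).1 ≠ 0 := fun h => hcol (by simp [h])
  obtain ⟨F, hkF⟩ := (mem_foreAft_or_flank k).resolve_left fun h => by
    rcases h with rfl | rfl <;> exact hk rfl
  have hkf : k = f - 1 ∨ k = f + 1 := by
    by_contra! hne
    obtain ⟨j, hj⟩ := exists_unitVec_eq_add (by rw [hfe]) hk hne.1 hne.2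
    exact hzv ⟨j, by rw [hj, add_assoc]⟩
  have hswap : z + unitVec f + unitVec k = z + unitVec k + unitVec f := add_right_comm _ _ _
  by_cases ht : z + unitVec k ∈ S
  · have hst : seg S (z + unitVec k) = seg S (z + unitVec f + unitVec k) :=
      seg_eq_of_adj ht hvS ⟨f, hswap⟩ (by simp [hfe])
    have hin : Inward S z (z + unitVec k) :=
      ⟨ht, ⟨k, rfl⟩, by rwa [depth_congr hst, hdepth]⟩
    rw [hswap] at hvS ⊢
    exact hc.mem_of_notMem_delayedWalls hS hf hz hdelay hkF hkf hin hvS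
  · refine absurd (hc.mem_of_end hS he hz hseg hn (by simp [hfe]) hv hzv fun h => ht ?_) hnX
    rwa [hswap, hfe, Prod.fst_add, Prod.snd_add, add_zero, add_sub_cancel_right] at h

theorem Invariant.isAttachable_of_flank (hc : Invariant S c) (hS : HoleFree S) (hw : w ∈ F.walls)
    (hz : z ∈ c.occ) (hn : z + unitVec w ∈ S) (hnX : z + unitVec w ∉ c.occ)
    (hfore : status (perimeter S) c.occ z 0 ≠ .free) (haft : status (perimeter S) c.occ z 3 ≠ .free)
    (hwhy : (∃ w' ∈ F.walls, status (perimeter S) c.occ z w' = .occupied) ∨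
      (c.mem z).flag F = true) :
    IsAttachable S c.occ (z + unitVec w) := by
  obtain ⟨hzS, hj, -, -, -, hflag⟩ := hc.settled z hz
  have hcol : (z + unitVec w).1 = z.1 + F.dir := congrArg (z.1 + ·) (mem_walls_iff.1 hw)
  have hne : z.1 ≠ (z + unitVec w).1 := by rw [hcol]; cases F <;> simp [Flank.dir]
  have hin := hc.inward_of_notMem hS hz hn hnX ⟨w, rfl⟩ hne
  have hjn := hj.of_adj hzS hn ⟨w, rfl⟩
  refine ⟨hn, hjn, fun v hv => ?_, ?_⟩
  · have hvc := hv.column_eq hin hS hn hjn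
    have hrow := row_close_of_adj hv.adj hin.adj hvc (hv.column_ne hn)
    have hoff (f : Wall) (hf : status (perimeter S) c.occ z f ≠ .free) (h : v = z + unitVec f) :
        v ∈ c.occ := by
      rw [Ne, status_eq_free_iff hS, ← h] at hf
      exact not_not.1 fun hvX => hf ⟨hv.mem, hvX⟩
    rcases (by omega : v.2 = z.2 ∨ v.2 = z.2 + 1 ∨ v.2 = z.2 - 1) with h | h | h
    · rwa [Prod.ext hvc h]
    · exact hoff 0 hfore (Prod.ext (by simp [hvc, unitVec]) h)
    · exact hoff 3 haft (Prod.ext (by simp [hvc, unitVec]) h)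
  rcases hwhy with ⟨w', hw', hocc⟩ | hα
  · obtain ⟨hmS, hmX⟩ := (status_eq_occupied_iff hS).1 hocc
    have hmc : (z + unitVec w').1 = (z + unitVec w).1 := by
      rw [hcol, ← mem_walls_iff.1 hw', Prod.fst_add]
    exact .inl ⟨_, hmX, seg_eq_of_adj_of_adj hmS hn ⟨w', rfl⟩ ⟨w, rfl⟩ hmc (hmc ▸ hne),
      row_close_of_adj ⟨w', rfl⟩ ⟨w, rfl⟩ hmc (hmc ▸ hne)⟩
  · exact .inr ⟨z, hn, hin, F, hflag F hα, hcol⟩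

theorem Invariant.isAttachable (hc : Invariant S c) (hS : HoleFree S) (hn : n ∉ c.occ)
    (h : Signaled (perimeter S) c n) : IsAttachable S c.occ n := by
  obtain ⟨z, hz, w, ⟨hw, hdelay⟩, rfl⟩ := h
  obtain ⟨hzS, hj, -⟩ := hc.settled z hz
  have hnS : z + unitVec w ∈ S := ((status_eq_free_iff hS).1 hw.2.1).1
  rcases mem_foreAft_or_flank w with hf | ⟨F, hF⟩
  · refine ⟨hnS, hj.of_adj hzS hnS ⟨w, rfl⟩,
      fun v => hc.inward_mem_of_foreAft hS hf hz hnS hn hdelay,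
      .inl ⟨z, hz, seg_eq_of_adj hzS hnS ⟨w, rfl⟩ ?_, ?_⟩⟩
    · rcases hf with rfl | rfl <;> simp [unitVec]
    · rcases hf with rfl | rfl <;> simp [unitVec, add_assoc]
  · obtain ⟨⟨hfore, haft⟩, hwhy⟩ := exists_occupied_or_flag hw hF
    exact hc.isAttachable_of_flank hS hF hz hnS hn hfore haft hwhy

end Attachment

section Preservation

variable {S X N : Finset Cell} {c c' : Config} {x y z n v : Cell} {F : Flank}

theorem initialMemory_growth (hS : HoleFree S) (hn : n ∈ S) (hj : Joined S n)
    (hin : ∀ v, Inward S n v → v ∈ X) (hout : ∀ x ∈ X, ¬ Inward S x n) (hv : Inward S n v)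
    (hc : v.1 = n.1 + F.dir) : (initialMemory (perimeter S) X n).g = -F.dir := by
  have hfree : ∀ w ∈ F.walls, status (perimeter S) X n w ≠ .free := by
    intro w hw hw'
    obtain ⟨hwS, hwX⟩ := (status_eq_free_iff hS).1 hw'
    refine hwX (hin _ (hv.of_adj hn hwS ⟨w, rfl⟩ ?_))
    rw [hc, ← mem_walls_iff.1 hw, Prod.fst_add]
  have hother : ∀ F' ≠ F, ∀ w ∈ F'.walls, status (perimeter S) X n w ≠ .occupied := by
    intro F' hF' w hw hocc
    obtain ⟨hwS, hwX⟩ := (status_eq_occupied_iff hS).1 hocc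
    have hwc : (n + unitVec w).1 = n.1 + F'.dir := congrArg (n.1 + ·) (mem_walls_iff.1 hw)
    have hne : n.1 ≠ (n + unitVec w).1 := by rw [hwc]; cases F' <;> simp [Flank.dir]
    refine (hS.inward_or_inward hj hn hwS ⟨w, rfl⟩ hne).elim (fun hw' => hF' ?_) (hout _ hwX)
    have hcol := hw'.column_eq hv hS hn hj
    exact Flank.dir_injective (add_left_cancel (hwc.symm.trans (hcol.trans hc)))
  obtain ⟨k, rfl⟩ := hv.adj
  have hocc : status (perimeter S) X n k = .occupied :=
    (status_eq_occupied_iff hS).2 ⟨hv.mem, hin _ hv⟩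
  exact growthDirection_eq (α := nucleation (perimeter S) (status (perimeter S) X n) n)
    (nucleation_eq_false hfree) ⟨k, mem_walls_iff.2 (add_left_cancel hc), hocc⟩ hother

theorem initialMemory_flag (hS : HoleFree S) (h : (initialMemory (perimeter S) X x).flag F = true) :
    IsNucleationSite S x F := by
  cases F <;> exact isNucleationSite_of_nucleation hS h

theorem Invariant.exists_occ_row_close (hc : Invariant S c) (hS : HoleFree S)
    (hN : ∀ n ∈ N, IsAttachable S c.occ n) {m : Cell} (hm : m ∈ c.occ) (hz : z ∈ c.occ ∪ N)
    (hmz : seg S m = seg S z) :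
    ∃ z' ∈ c.occ, seg S z' = seg S z ∧ z'.2 ≤ z.2 + 1 ∧ z.2 ≤ z'.2 + 1 := by
  rcases Finset.mem_union.1 hz with hz | hz
  · exact ⟨z, hz, rfl, by omega, by omega⟩
  obtain ⟨-, hj, -, h | ⟨x, hx⟩⟩ := hN z hz
  · exact h
  have hd : depth S m ≠ 0 := by
    rw [depth_congr hmz]
    exact Nat.ne_zero_of_lt hx.inward.depth_lt
  obtain ⟨x', y, hy, hxy, hym⟩ := (hc.settled m hm).seeded hd
  have hyz := hym.trans hmz
  obtain rfl := hx.unique hS hxy hj hyz.symm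
  exact ⟨y, hy, hyz, hxy.row_close hx (column_eq_of_seg_eq hyz)⟩

theorem Invariant.isContiguous_union (hc : Invariant S c) (hS : HoleFree S)
    (hN : ∀ n ∈ N, IsAttachable S c.occ n) : IsContiguous S (c.occ ∪ N) := by
  intro x hx y hy hxy k hxk hky
  have hcol := column_eq_of_seg_eq hxy
  rcases hxk.eq_or_lt with rfl | hxk
  · exact hx
  rcases hky.eq_or_lt with rfl | hky
  · rwa [hcol]
  by_cases hm : ∃ m ∈ c.occ, seg S m = seg S x
  · obtain ⟨m, hm, hmx⟩ := hm
    obtain ⟨x', hx', hxx, hrx⟩ := hc.exists_occ_row_close hS hN hm hx hmx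
    obtain ⟨y', hy', hyy, hry⟩ := hc.exists_occ_row_close hS hN hm hy (hmx.trans hxy)
    rw [← column_eq_of_seg_eq hxx]
    exact Finset.mem_union_left _ (hc.contiguous x' hx' y' hy'
      (hxx.trans (hxy.trans hyy.symm)) k (by omega) (by omega))
  · have hnew {z : Cell} (hz : z ∈ c.occ ∪ N) (hzx : seg S z = seg S x) :
        ∃ s, IsSeed S s z ∧ Joined S z := by
      have hzN := (Finset.mem_union.1 hz).resolve_left fun hz => hm ⟨z, hz, hzx⟩
      obtain ⟨-, hj, -, ⟨m, hmX, hmz, -⟩ | ⟨s, hs⟩⟩ := hN z hzN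
      · exact absurd ⟨m, hmX, hmz.trans hzx⟩ hm
      · exact ⟨s, hs, hj⟩
    obtain ⟨s, hsx, hj⟩ := hnew hx rfl
    obtain ⟨s', hsy, -⟩ := hnew hy hxy.symm
    obtain rfl := hsx.unique hS hsy hj hxy
    have hrow := hsx.row_close hsy hcol
    omega

theorem IsAttachable.isSettled (hn : IsAttachable S c.occ n) (hc : Invariant S c) (hS : HoleFree S)
    (hX : c.occ ⊆ X) (hnX : n ∈ X) (hout : ∀ x ∈ X, ¬ Inward S x n) :
    IsSettled S X n (initialMemory (perimeter S) X n) := by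
  have hin : ∀ v, Inward S n v → v ∈ X := fun v hv => hX (hn.inward_mem v hv)
  refine ⟨hn.mem_shape, hn.joined, hin, fun hd => ?_, fun F v hv hvc => ?_, fun F hF => ?_⟩
  · rcases hn.origin with ⟨m, hm, hmn, -⟩ | ⟨x, hx⟩
    · obtain ⟨x, y, hy, hxy, hym⟩ := (hc.settled m hm).seeded (by rwa [depth_congr hmn])
      exact ⟨x, y, hX hy, hxy, hym.trans hmn⟩
    · exact ⟨x, n, hnX, hx, rfl⟩
  · exact initialMemory_growth hS hn.mem_shape hn.joined hin hout hv hvc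
  · exact initialMemory_flag hS hF

theorem Invariant.step (hc : Invariant S c) (hS : HoleFree S) (h : Step (perimeter S) c c') :
    Invariant S c' := by
  obtain ⟨N, hN, hocc, hold, hnew⟩ := h
  have hat : ∀ n ∈ N, IsAttachable S c.occ n := fun n hn =>
    hc.isAttachable hS (hN n hn).1 (hN n hn).2
  have hsub : c.occ ⊆ c'.occ := hocc ▸ Finset.subset_union_left
  have hsub' : N ⊆ c'.occ := hocc ▸ Finset.subset_union_right
  have hcase (z) (hz : z ∈ c'.occ) : z ∈ c.occ ∨ z ∈ N := by rwa [hocc, Finset.mem_union] at hz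
  have hout : ∀ n ∈ N, ∀ x ∈ c'.occ, ¬ Inward S x n := fun n hn x hx hxn =>
    (hN n hn).1 ((hcase x hx).elim (fun hx => (hc.settled x hx).inward_mem n hxn)
      fun hx => (hat x hx).inward_mem n hxn)
  refine ⟨fun z hz => ?_, hocc ▸ hc.isContiguous_union hS hat⟩
  rcases hcase z hz with hz | hz
  · rw [hold z hz]
    exact (hc.settled z hz).mono hsub
  · rw [hnew z hz]
    exact (hat z hz).isSettled hc hS hsub (hsub' hz) (hout z hz)

theorem invariant_of_isExecution (hS : HoleFree S) (hroot : ((0, 0) : Cell) ∈ S)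
    {run : ℕ → Config} (hrun : IsExecution (perimeter S) run) (t : ℕ) : Invariant S (run t) := by
  obtain ⟨hocc, hmem, hstep⟩ := hrun
  induction t with
  | zero =>
    refine ⟨fun z hz => ?_, fun x hx y hy _ k hxk hky => ?_⟩
    · rw [hocc, Finset.mem_singleton] at hz
      subst hz
      rw [hmem]
      exact ⟨hroot, .refl _, fun v hv => absurd hv not_inward_root,
        fun hd => absurd SimpleGraph.dist_self hd, fun _ v hv => absurd hv not_inward_root,
        fun _ => initialMemory_flag hS⟩
    · rw [hocc, Finset.mem_singleton] at hx hy ⊢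
      subst hx hy
      exact Prod.ext rfl (le_antisymm hky hxk)
  | succ t ih => exact ih.step hS (hstep t)

end Preservation

section Degrees

variable {S X : Finset Cell} {c : Config} {x y : Cell}

theorem degreeIfAdded_pos (hx : x ∈ X) (h : hexGraph.Adj y x) : 1 ≤ degreeIfAdded X y :=
  (SimpleGraph.degree_pos_iff_exists_adj _ _).2 ⟨⟨x, Finset.mem_insert_of_mem hx⟩, h⟩

theorem degreeIfAdded_le_card (X : Finset Cell) (y : Cell) :
    degreeIfAdded X y ≤ (Finset.univ.filter fun w : Wall => y + unitVec w ∈ X).card := by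
  rw [degreeIfAdded, ← SimpleGraph.card_neighborFinset_eq_degree,
    ← Finset.card_image_of_injective _ Subtype.val_injective]
  refine (Finset.card_le_card fun v hv => ?_).trans
    (Finset.card_image_le (f := fun w : Wall => y + unitVec w))
  obtain ⟨⟨v, hvX⟩, hadj, rfl⟩ := Finset.mem_image.1 hv
  rw [SimpleGraph.mem_neighborFinset] at hadj
  obtain ⟨w, rfl⟩ : hexGraph.Adj y v := hadj
  refine Finset.mem_image.2 ⟨w, Finset.mem_filter.2 ⟨Finset.mem_univ _, ?_⟩, rfl⟩
  exact (Finset.mem_insert.1 hvX).resolve_left fun h => unitVec_ne_zero w (by simpa using h)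

theorem card_walls_le_three : ∀ W : Finset Wall, ¬ (0 ∈ W ∧ 3 ∈ W) →
    (∀ w ∈ W, ∀ w' ∈ W, (unitVec w).1 ≠ 0 → (unitVec w').1 ≠ 0 →
      (unitVec w).1 = (unitVec w').1) → W.card ≤ 3 := by
  decide

theorem Invariant.maintainsReachability (hc : Invariant S c) (hS : HoleFree S) :
    MaintainsReachability S c.occ := by
  rintro y ⟨hyS, hyX, x, hx, hyx⟩
  have hj : Joined S y := (hc.settled x hx).joined.of_adj (hc.settled x hx).mem_shape hyS hyx.symm
  refine ⟨degreeIfAdded_pos hx hyx, (degreeIfAdded_le_card _ y).trans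
    (card_walls_le_three _ ?_ ?_)⟩
  · simp only [Finset.mem_filter, Finset.mem_univ, true_and]
    rintro ⟨h0, h3⟩
    have hs0 := seg_eq_of_adj hyS (hc.settled _ h0).mem_shape ⟨0, rfl⟩ (by simp [unitVec])
    have hs3 := seg_eq_of_adj hyS (hc.settled _ h3).mem_shape ⟨3, rfl⟩ (by simp [unitVec])
    have hy := hc.contiguous _ h3 _ h0 (hs3.symm.trans hs0) y.2 (by simp [unitVec])
      (by simp [unitVec])
    rw [← column_eq_of_seg_eq hs3] at hy
    exact hyX hy
  · simp only [Finset.mem_filter, Finset.mem_univ, true_and]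
    intro w hw w' hw' hne hne'
    have hin {w : Wall} (hw : y + unitVec w ∈ c.occ) (hne : (unitVec w).1 ≠ 0) :
        Inward S y (y + unitVec w) :=
      have hadj : hexGraph.Adj y (y + unitVec w) := ⟨w, rfl⟩
      hc.inward_of_notMem hS hw hyS hyX hadj.symm (by simpa using hne)
    exact add_left_cancel ((hin hw hne).column_eq (hin hw' hne') hS hyS hj)

end Degrees

end Huddle

end

theorem theorem1 (S : Finset Huddle.Cell) (hS : Huddle.HoleFree S)
    (hroot : ((0, 0) : Huddle.Cell) ∈ S)
    (run : ℕ → Huddle.Config)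
    (hrun : Huddle.IsExecution (Huddle.perimeter S) run) (t : ℕ) :
    Huddle.MaintainsReachability S (run t).occ :=
  (Huddle.invariant_of_isExecution hS hroot hrun t).maintainsReachability hS
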